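/- Let $\mathbb F$ be a field, let $1\le h\le n$, and let $\mu$ be the hook partition of $n$ with parts $1^{h-1},\,n-h+1$, viewed as the composition $(1,\dots,1,n-h+1)$ of $n$. Notation. For $i=1,\dots,n-1$ let $s_i=(i,i+1)$ act on $\mathbb F[\mathbf x]=\mathbb F[x_1,\dots,x_n]$ by permuting variables, and put $\pi_i f=\dfrac{x_if-x_{i+1}s_i(f)}{x_i-x_{i+1}}$ and $\overline\pi_i=\pi_i-1$. The $0$-Hecke algebra $H_n(0)$ is the $\mathbb F$-algebra generated by $T_1,\dots,T_{n-1}$ with relations $T_i^2=-T_i$, $T_iT_j=T_jT_i$ for $|i-j|\ge 2$, and $T_iT_{i+1}T_i=T_{i+1}T_iT_{i+1}$; put $T_i'=T_i+1$. For $w\in\mathfrak S_n$ let $T_w$, $T'_w$, $\overline\pi_w$ be the products of the $T_i$, $T_i'$, $\overline\pi_i$ along a reduced word of $w$. The descent set of $w\in\mathfrak S_n$ is $D(w)=\{i: w(i)>w(i+1)\}$; the descent set of a composition $\alpha=(\alpha_1,\dots,\alpha_\ell)$ of $n$ is $D(\alpha)=\{\alpha_1+\cdots+\alpha_j: 0<j<\ell\}$;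 write $\alpha\preccurlyeq\beta$ if $D(\alpha)\subseteq D(\beta)$, and let $\alpha^c$ be the composition of $n$ with $D(\alpha^c)=\{1,\dots,n-1\}\setminus D(\alpha)$. Let $w_0(\alpha)$ be the longest element of the subgroup generated by $\{s_i:i\in D(\alpha)\}$, and let $\mathbf P_\alpha=H_n(0)\,T_{w_0(\alpha)}T'_{w_0(\alpha^c)}$. For $I\subseteq\{1,\dots,n-1\}$ put $x_I=\prod_{i\in I}x_1\cdots x_i$. Let $\mu'_1\le\cdots\le\mu'_n$ be the parts of the conjugate of $\mu$, padded with zeros on the left, let $d_k(\mu)=\mu_1'+\cdots+\mu_k'$, let $I_\mu$ be the ideal of $\mathbb F[\mathbf x]$ generated by all elementary symmetric polynomials $e_r(S)$ with $S\subseteq\{x_1,\dots,x_n\}$, $|S|=k\geq 1$ and $k\ge r>k-d_k(\mu)$, and let $R_\mu=\mathbb F[\mathbf x]/I_\mu$. Theorem. $R_\mu$ is an $H_n(0)$-module on which each $T_i$ acts as the operator induced by $\overline\pi_i$. This module is projective and $$R_\mu\;\cong\;\bigoplus_{\alpha\preccurlyeq\mu}\mathbf P_\alpha$$ as $H_n(0)$-modules,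 the sum being over all compositions $\alpha$ of $n$ with $\alpha\preccurlyeq\mu$. Moreover, the images in $R_\mu$ of the Demazure atoms $\overline\pi_w x_{D(w)}$, for $w\in\mathfrak S_n$ with $D(w)\subseteq D(\mu)$, form an $\mathbb F$-basis of $R_\mu$. -/

import Mathlib

noncomputable section

namespace ZeroHecke

open MvPolynomial

/-! ## Permutations, reduced words, descents

The index `i : Fin (n - 1)` stands for the integer `i + 1 ∈ {1, …, n - 1}`,
and `j : Fin n` stands for `j + 1 ∈ {1, …, n}`. -/

/-- The position `i`, as an element of `{1, …, n}`. -/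
def lo {n : ℕ} (i : Fin (n - 1)) : Fin n := ⟨i, by omega⟩

/-- The position `i + 1`, as an element of `{1, …, n}`. -/
def hi {n : ℕ} (i : Fin (n - 1)) : Fin n := ⟨i + 1, by omega⟩

/-- The adjacent transposition `s_i = (i, i + 1)`. -/
def adjSwap {n : ℕ} (i : Fin (n - 1)) : Equiv.Perm (Fin n) := Equiv.swap (lo i) (hi i)

/-- The permutation `s_{i₁} ⋯ s_{iₖ}` expressed by the word `i₁, …, iₖ`. -/
def wordProd {n : ℕ} (l : List (Fin (n - 1))) : Equiv.Perm (Fin n) := (l.map adjSwap).prod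

/-- `l` is a reduced word of `w`: it expresses `w`, and no shorter word does. -/
def IsReducedWord {n : ℕ} (l : List (Fin (n - 1))) (w : Equiv.Perm (Fin n)) : Prop :=
  wordProd l = w ∧ ∀ l' : List (Fin (n - 1)), wordProd l' = w → l.length ≤ l'.length

theorem exists_wordProd {n : ℕ} (w : Equiv.Perm (Fin n)) :
    ∃ l : List (Fin (n - 1)), wordProd l = w := by
  cases n with
  | zero => exact ⟨[], Subsingleton.elim _ _⟩
  | succ m =>
    have hw : w ∈ Submonoid.closure
        (Set.range fun i : Fin m => Equiv.swap i.castSucc i.succ) := by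
      rw [Equiv.Perm.mclosure_swap_castSucc_succ]; trivial
    induction hw using Submonoid.closure_induction with
    | mem x hx =>
      obtain ⟨i, rfl⟩ := hx
      exact ⟨[i], by simp [wordProd, adjSwap]; rfl⟩
    | one => exact ⟨[], by simp [wordProd]⟩
    | mul x y _ _ hx hy =>
      obtain ⟨l₁, rfl⟩ := hx
      obtain ⟨l₂, rfl⟩ := hy
      exact ⟨l₁ ++ l₂, by simp [wordProd]⟩

theorem exists_isReducedWord {n : ℕ} (w : Equiv.Perm (Fin n)) :
    ∃ l : List (Fin (n - 1)), IsReducedWord l w := by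
  classical
  have h : ∃ k, ∃ l : List (Fin (n - 1)), wordProd l = w ∧ l.length = k := by
    obtain ⟨l, hl⟩ := exists_wordProd w
    exact ⟨_, l, hl, rfl⟩
  obtain ⟨l, hl, hk⟩ := Nat.find_spec h
  exact ⟨l, hl, fun l' hl' => hk ▸ Nat.find_min' h ⟨l', hl', rfl⟩⟩

/-- A reduced word of `w`. Operators indexed by `w` below are products along a reduced word;
by the braid relations they do not depend on which one is taken. -/
def reducedWord {n : ℕ} (w : Equiv.Perm (Fin n)) : List (Fin (n - 1)) :=
  Classical.choose (exists_isReducedWord w)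

theorem reducedWord_spec {n : ℕ} (w : Equiv.Perm (Fin n)) :
    IsReducedWord (reducedWord w) w :=
  Classical.choose_spec (exists_isReducedWord w)

/-- The length `ℓ(w)`. -/
def len {n : ℕ} (w : Equiv.Perm (Fin n)) : ℕ := (reducedWord w).length

/-- The descent set `D(w) = {i : w(i) > w(i + 1)}`. -/
def descents {n : ℕ} (w : Equiv.Perm (Fin n)) : Finset (Fin (n - 1)) :=
  Finset.univ.filter fun i => w (hi i) < w (lo i)

/-- The parabolic subgroup generated by the `s_i` with `i ∈ J`. -/
def parabolic {n : ℕ} (J : Finset (Fin (n - 1))) : Subgroup (Equiv.Perm (Fin n)) :=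
  Subgroup.closure (adjSwap '' (J : Set (Fin (n - 1))))

theorem exists_longest {n : ℕ} (J : Finset (Fin (n - 1))) :
    ∃ w ∈ parabolic J, ∀ v ∈ parabolic J, len v ≤ len w :=
  Set.exists_max_image (parabolic J : Set (Equiv.Perm (Fin n))) len (Set.toFinite _)
    ⟨1, (parabolic J).one_mem⟩

/-- The longest element of the parabolic subgroup of `J`. -/
def longest {n : ℕ} (J : Finset (Fin (n - 1))) : Equiv.Perm (Fin n) :=
  Classical.choose (exists_longest J)

theorem longest_spec {n : ℕ} (J : Finset (Fin (n - 1))) :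
    longest J ∈ parabolic J ∧ ∀ v ∈ parabolic J, len v ≤ len (longest J) :=
  Classical.choose_spec (exists_longest J)

/-! ## Compositions and partitions -/

/-- The descent set of a composition `α`: the partial sums `α₁ + ⋯ + αⱼ`, `0 < j < ℓ(α)`. -/
def compDescents {n : ℕ} (α : Composition n) : Finset (Fin (n - 1)) :=
  Finset.univ.filter fun i => (i : ℕ) + 1 ∈ (Finset.Ioo 0 α.length).image α.sizeUpTo

/-- `α ≼ β` means `D(α) ⊆ D(β)`. -/
def CompLE {n : ℕ} (α β : Composition n) : Prop := compDescents α ⊆ compDescents β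

/-- A partition viewed as the composition listing its (nonzero) parts in increasing order. -/
def toComposition {n : ℕ} (μ : n.Partition) : Composition n where
  blocks := μ.parts.sort (· ≤ ·)
  blocks_pos := fun h => μ.parts_pos ((Multiset.mem_sort _).1 h)
  blocks_sum := by
    rw [← Multiset.sum_coe, Multiset.sort_eq, μ.parts_sum]

/-- `μ` is a hook: its parts are `h - 1` ones and `n - h + 1`, for some `1 ≤ h ≤ n`. -/
def IsHook {n : ℕ} (μ : n.Partition) : Prop :=
  ∃ h : ℕ, 1 ≤ h ∧ h ≤ n ∧ μ.parts = (n - h + 1) ::ₘ Multiset.replicate (h - 1) 1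

/-- The parts `μ'₁ ≤ ⋯ ≤ μ'ₙ` of the conjugate of `μ`, listed increasingly and padded with zeros
on the left: `μ'ⱼ` is the number of parts of `μ` that are at least `n + 1 - j`. -/
def conjPart {n : ℕ} (μ : n.Partition) (j : ℕ) : ℕ :=
  (μ.parts.filter fun p => n + 1 - j ≤ p).card

/-- `d_k(μ) = μ'₁ + ⋯ + μ'ₖ`. -/
def dSum {n : ℕ} (μ : n.Partition) (k : ℕ) : ℕ := ∑ j ∈ Finset.Icc 1 k, conjPart μ j

/-! ## The 0-Hecke algebra of the symmetric group -/

section Algebra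

variable (F : Type*) [Field F] (n : ℕ)

/-- The defining relations of `H_n(0)`. -/
inductive HeckeRel : FreeAlgebra F (Fin (n - 1)) → FreeAlgebra F (Fin (n - 1)) → Prop
  | quad (i : Fin (n - 1)) :
      HeckeRel (FreeAlgebra.ι F i * FreeAlgebra.ι F i) (-FreeAlgebra.ι F i)
  | comm (i j : Fin (n - 1)) (hij : (i : ℕ) + 1 < j) :
      HeckeRel (FreeAlgebra.ι F i * FreeAlgebra.ι F j) (FreeAlgebra.ι F j * FreeAlgebra.ι F i)
  | braid (i j : Fin (n - 1)) (hij : (i : ℕ) + 1 = j) :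
      HeckeRel (FreeAlgebra.ι F i * FreeAlgebra.ι F j * FreeAlgebra.ι F i)
        (FreeAlgebra.ι F j * FreeAlgebra.ι F i * FreeAlgebra.ι F j)

/-- The 0-Hecke algebra `H_n(0)` over `F`. -/
abbrev Hecke : Type _ := RingQuot (HeckeRel F n)

variable {n}

/-- The generator `T_i`. -/
def T (i : Fin (n - 1)) : Hecke F n := RingQuot.mkAlgHom F (HeckeRel F n) (FreeAlgebra.ι F i)

/-- The generator `T'_i = T_i + 1`. -/
def T' (i : Fin (n - 1)) : Hecke F n := T F i + 1

/-- `T_w`, the product of the `T_i` along a reduced word of `w`. -/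
def Tperm (w : Equiv.Perm (Fin n)) : Hecke F n := ((reducedWord w).map (T F)).prod

/-- `T'_w`, the product of the `T'_i` along a reduced word of `w`. -/
def Tperm' (w : Equiv.Perm (Fin n)) : Hecke F n := ((reducedWord w).map (T' F)).prod

/-- The projective indecomposable module `P_α = H_n(0) · T_{w₀(α)} T'_{w₀(αᶜ)}`, a left ideal of
`H_n(0)`. Here `w₀(α)` is the longest element of the parabolic subgroup of `D(α)`, and
`D(αᶜ)` is the complement of `D(α)`. -/
def projIndec (α : Composition n) : Submodule (Hecke F n) (Hecke F n) :=
  Submodule.span (Hecke F n)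
    {Tperm F (longest (compDescents α)) * Tperm' F (longest (compDescents α)ᶜ)}

/-! ## Demazure operators and atoms -/

theorem demazure_dvd (i : Fin (n - 1)) (f : MvPolynomial (Fin n) F) :
    (X (lo i) - X (hi i) : MvPolynomial (Fin n) F) ∣
      X (lo i) * f - X (hi i) * rename (adjSwap i) f := by
  rw [← Ideal.mem_span_singleton, ← Ideal.Quotient.mk_eq_mk_iff_sub_mem]
  have hX : Ideal.Quotient.mkₐ F (Ideal.span {(X (lo i) - X (hi i) : MvPolynomial (Fin n) F)})
      (X (lo i)) = Ideal.Quotient.mkₐ F _ (X (hi i)) :=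
    (Ideal.Quotient.mk_eq_mk_iff_sub_mem _ _).2 (Ideal.mem_span_singleton_self _)
  have hA : (Ideal.Quotient.mkₐ F
        (Ideal.span {(X (lo i) - X (hi i) : MvPolynomial (Fin n) F)})).comp
        (rename (adjSwap i)) = Ideal.Quotient.mkₐ F _ := by
    refine MvPolynomial.algHom_ext fun j => ?_
    rw [AlgHom.comp_apply, rename_X, adjSwap]
    rcases eq_or_ne j (lo i) with rfl | h1
    · rw [Equiv.swap_apply_left]; exact hX.symm
    · rcases eq_or_ne j (hi i) with rfl | h2
      · rw [Equiv.swap_apply_right]; exact hX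
      · rw [Equiv.swap_apply_of_ne_of_ne h1 h2]
  have hf := DFunLike.congr_fun hA f
  rw [AlgHom.comp_apply] at hf
  rw [map_mul, map_mul]
  exact congrArg₂ (· * ·) hX hf.symm

theorem X_sub_X_ne_zero (i : Fin (n - 1)) :
    (X (lo i) - X (hi i) : MvPolynomial (Fin n) F) ≠ 0 := by
  rw [sub_ne_zero]
  intro h
  have := X_injective (σ := Fin n) (R := F) h
  simp [lo, hi] at this

/-- The quotient `(x_i f - x_{i+1} s_i(f)) / (x_i - x_{i+1})`, the division being exact. -/
def demazureFun (i : Fin (n - 1)) (f : MvPolynomial (Fin n) F) : MvPolynomial (Fin n) F :=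
  Classical.choose (demazure_dvd F i f)

theorem demazureFun_spec (i : Fin (n - 1)) (f : MvPolynomial (Fin n) F) :
    (X (lo i) - X (hi i)) * demazureFun F i f
      = X (lo i) * f - X (hi i) * rename (adjSwap i) f :=
  (Classical.choose_spec (demazure_dvd F i f)).symm

/-- The Demazure operator `π_i f = (x_i f - x_{i+1} s_i(f)) / (x_i - x_{i+1})`. -/
def demazure (i : Fin (n - 1)) : Module.End F (MvPolynomial (Fin n) F) where
  toFun := demazureFun F i
  map_add' f g := by
    apply mul_left_cancel₀ (X_sub_X_ne_zero F i)
    rw [mul_add, demazureFun_spec, demazureFun_spec, demazureFun_spec, map_add]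
    ring
  map_smul' c f := by
    apply mul_left_cancel₀ (X_sub_X_ne_zero F i)
    rw [RingHom.id_apply, mul_smul_comm, demazureFun_spec, demazureFun_spec, map_smul, smul_sub,
      mul_smul_comm, mul_smul_comm]

/-- `π̄_i = π_i - 1`. -/
def demazureBar (i : Fin (n - 1)) : Module.End F (MvPolynomial (Fin n) F) := demazure F i - 1

/-- `π̄_w`, the product of the `π̄_i` along a reduced word of `w`. -/
def demazureBarPerm (w : Equiv.Perm (Fin n)) : Module.End F (MvPolynomial (Fin n) F) :=
  ((reducedWord w).map (demazureBar F)).prod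

/-- `x_I`, the product over `i ∈ I` of `x₁ ⋯ x_i`. -/
def xMonomial (I : Finset (Fin (n - 1))) : MvPolynomial (Fin n) F :=
  ∏ i ∈ I, ∏ j ∈ Finset.Iic (lo i), X j

/-- The Demazure atom `π̄_w x_{D(w)}`. -/
def atom (w : Equiv.Perm (Fin n)) : MvPolynomial (Fin n) F :=
  demazureBarPerm F w (xMonomial F (descents w))

/-! ## The Tanisaki ideal -/

/-- The elementary symmetric polynomial `e_r(S)` in the variables indexed by `S`. -/
def esymmOn (S : Finset (Fin n)) (r : ℕ) : MvPolynomial (Fin n) F :=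
  ∑ A ∈ S.powersetCard r, ∏ j ∈ A, X j

/-- The Tanisaki ideal `I_μ`, generated by the `e_r(S)` with `|S| = k` and
`k ≥ r > k - d_k(μ)`, `k = 1, …, n`. -/
def tanisaki (μ : n.Partition) : Ideal (MvPolynomial (Fin n) F) :=
  Ideal.span {f | ∃ (S : Finset (Fin n)) (r : ℕ), 1 ≤ S.card ∧ r ≤ S.card ∧
    (S.card : ℤ) - dSum μ S.card < r ∧ f = esymmOn F S r}

/-- `R_μ = F[x₁, …, xₙ] / I_μ`. -/
abbrev springerRing (μ : n.Partition) : Type _ := MvPolynomial (Fin n) F ⧸ tanisaki F μ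

end Algebra

end ZeroHecke

end

/-!
The polynomial ring has an `F`-basis `e₁^{c₁} ⋯ eₙ^{cₙ} π̄_w x_{D(w)}`, indexed by the exponents
`c` and the permutations `w`, and it is adapted both to the Tanisaki ideal of a hook and to the
action of the 0-Hecke algebra.

*The basis.* An exponent is dominated by a partition `lam` when the sum of any `k` of its
entries is at most `lam₁ + ⋯ + lamₖ`; the extreme exponents are the rearrangements `u(lam)`. The
coefficients of a polynomial at these extreme exponents are multiplicative (`HasTop.mul`), and
`π̄_i` acts on them by a simple rule (`HasTop.demazureBar`). Those of an elementary symmetric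
polynomial are all `1` (`hasTop_esymmOn`), and the top part of `π̄_w x_{D(w)}` is the single
monomial `w(x_{D(w)})` (`hasTop_demazureBarPerm`). So the coefficient of
`e^c π̄_w x_{D(w)}` at `u(lam)` is `1` or `0` according to whether `u(x_{D(w)}) = w(x_{D(w)})`.
Sorting an exponent gives a bijection of the exponents with the pairs `(c, w)`, for which the family is
unitriangular (`linearIndependent_basisElt`, `span_basisElt`).

*The Tanisaki ideal.* For the hook with `h` parts, `D(μ) = {1, …, h - 1}`, and the ideal is the
sum of the ideal generated by the `e_k` and the ideal of polynomials whose monomials all involve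
at least `h` variables (`HookWith.tanisaki_eq`). Both are stable under `π̄_i`. Unitriangularity,
applied inside the second ideal, shows that the sum is spanned by the basis elements with
`c ≠ 0` or `D(w) ⊄ D(μ)` (`HookWith.mem_tanisaki_iff`), so the remaining ones, which are the
Demazure atoms with `D(w) ⊆ D(μ)`, form a basis of the quotient `R_μ`.

*The module structure.* Matsumoto's theorem (`BraidFamily.prod_eq`) gives the multiplication
rules of the `T_w`. They show that `P_α` is spanned by the elements `T_w T'_{w₀(D(w)ᶜ)}` with
`D(w) = D(α)` (`projIndec_le_span`). The morphism `⨁ P_α → R_μ` given by `p ↦ p • x_{D(α)}`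
sends these elements to the Demazure atoms (`HookWith.springerRep_heckeElt`), hence a spanning
family to a basis, and so it is bijective. In the same way `H_n(0)` itself is the direct sum of
all `P_α`: the elements `T_w T'_{w₀(D(w)ᶜ)}` differ from `T_w` by terms `T_u` with `u` longer,
and the `T_w` are linearly independent because they act independently on
`x₁^{n-1} x₂^{n-2} ⋯ x_{n-1}`. Hence every `P_α` is projective, and so is `R_μ`.
-/

noncomputable section

namespace ZeroHecke

open MvPolynomial

/-! ### Inversions, length and descents -/

section Perm

variable {n : ℕ}

/-- The inversions of `w`: the pairs of positions `p < q` with `w p > w q`. -/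
def inversions (w : Equiv.Perm (Fin n)) : Finset (Fin n × Fin n) :=
  Finset.univ.filter fun p => p.1 < p.2 ∧ w p.2 < w p.1

theorem mem_inversions {w : Equiv.Perm (Fin n)} {p q : Fin n} :
    (p, q) ∈ inversions w ↔ p < q ∧ w q < w p := by
  simp [inversions]

theorem mem_descents {w : Equiv.Perm (Fin n)} {i : Fin (n - 1)} :
    i ∈ descents w ↔ w (hi i) < w (lo i) := by
  simp [descents]

theorem lo_lt_hi (i : Fin (n - 1)) : lo i < hi i := by
  simp [lo, hi]

theorem lo_ne_hi (i : Fin (n - 1)) : lo i ≠ hi i := (lo_lt_hi i).ne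

@[simp] theorem adjSwap_lo (i : Fin (n - 1)) : adjSwap i (lo i) = hi i :=
  Equiv.swap_apply_left _ _

@[simp] theorem adjSwap_hi (i : Fin (n - 1)) : adjSwap i (hi i) = lo i :=
  Equiv.swap_apply_right _ _

theorem adjSwap_of_ne {i : Fin (n - 1)} {a : Fin n} (h₁ : a ≠ lo i) (h₂ : a ≠ hi i) :
    adjSwap i a = a :=
  Equiv.swap_apply_of_ne_of_ne h₁ h₂

@[simp] theorem adjSwap_mul_self (i : Fin (n - 1)) : adjSwap i * adjSwap i = 1 :=
  Equiv.swap_mul_self _ _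

@[simp] theorem adjSwap_mul_cancel (i : Fin (n - 1)) (w : Equiv.Perm (Fin n)) :
    adjSwap i * (adjSwap i * w) = w := by
  rw [← mul_assoc, adjSwap_mul_self, one_mul]

@[simp] theorem mul_adjSwap_cancel (i : Fin (n - 1)) (w : Equiv.Perm (Fin n)) :
    w * adjSwap i * adjSwap i = w := by
  rw [mul_assoc, adjSwap_mul_self, mul_one]

@[simp] theorem adjSwap_inv (i : Fin (n - 1)) : (adjSwap i)⁻¹ = adjSwap i :=
  Equiv.swap_inv _ _

@[simp] theorem adjSwap_apply_apply (i : Fin (n - 1)) (a : Fin n) :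
    adjSwap i (adjSwap i a) = a :=
  Equiv.swap_apply_self _ _ _

theorem adjSwap_lt_adjSwap_iff {i : Fin (n - 1)} {a b : Fin n}
    (h₁ : ¬(a = lo i ∧ b = hi i)) (h₂ : ¬(a = hi i ∧ b = lo i)) :
    adjSwap i a < adjSwap i b ↔ a < b := by
  simp only [adjSwap, Equiv.swap_apply_def, Fin.ext_iff, lo, hi, Fin.lt_def] at *
  split_ifs <;> simp_all <;> omega

theorem inversions_adjSwap_mul {i : Fin (n - 1)} {v : Equiv.Perm (Fin n)}
    (h : v⁻¹ (lo i) < v⁻¹ (hi i)) :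
    inversions (adjSwap i * v) = insert (v⁻¹ (lo i), v⁻¹ (hi i)) (inversions v) := by
  ext ⟨p, q⟩
  rw [Finset.mem_insert, mem_inversions, mem_inversions, Prod.mk.injEq, Equiv.Perm.mul_apply,
    Equiv.Perm.mul_apply]
  by_cases h₁ : v q = lo i ∧ v p = hi i
  · have hp : p = v⁻¹ (hi i) := by rw [← h₁.2]; simp
    have hq : q = v⁻¹ (lo i) := by rw [← h₁.1]; simp
    subst hp hq
    constructor
    · exact fun h' => absurd h h'.1.not_gt
    · rintro (h' | h')
      · rw [h'.1] at h; exact absurd h (lt_irrefl _)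
      · exact absurd h h'.1.not_gt
  by_cases h₂ : v q = hi i ∧ v p = lo i
  · have hp : p = v⁻¹ (lo i) := by rw [← h₂.2]; simp
    have hq : q = v⁻¹ (hi i) := by rw [← h₂.1]; simp
    subst hp hq
    simpa using ⟨h, lo_lt_hi i⟩
  rw [adjSwap_lt_adjSwap_iff h₁ h₂]
  have h₃ : ¬(p = v⁻¹ (lo i) ∧ q = v⁻¹ (hi i)) := by
    rintro ⟨rfl, rfl⟩; simp at h₂
  rw [or_iff_right h₃]

theorem card_inversions_adjSwap_mul {i : Fin (n - 1)} {v : Equiv.Perm (Fin n)}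
    (h : v⁻¹ (lo i) < v⁻¹ (hi i)) :
    (inversions (adjSwap i * v)).card = (inversions v).card + 1 := by
  rw [inversions_adjSwap_mul h, Finset.card_insert_of_notMem]
  rw [mem_inversions]
  simpa using fun _ => (lo_lt_hi i).le

theorem inv_lo_lt_or_gt (v : Equiv.Perm (Fin n)) (i : Fin (n - 1)) :
    v⁻¹ (lo i) < v⁻¹ (hi i) ∨ v⁻¹ (hi i) < v⁻¹ (lo i) :=
  lt_or_gt_of_ne fun h => lo_ne_hi i (v⁻¹.injective h)

theorem inv_adjSwap_mul_lt_iff (v : Equiv.Perm (Fin n)) (i : Fin (n - 1)) :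
    (adjSwap i * v)⁻¹ (lo i) < (adjSwap i * v)⁻¹ (hi i) ↔ v⁻¹ (hi i) < v⁻¹ (lo i) := by
  simp [mul_inv_rev]

theorem card_inversions_adjSwap_mul_of_gt {i : Fin (n - 1)} {v : Equiv.Perm (Fin n)}
    (h : v⁻¹ (hi i) < v⁻¹ (lo i)) :
    (inversions (adjSwap i * v)).card + 1 = (inversions v).card := by
  rw [← card_inversions_adjSwap_mul ((inv_adjSwap_mul_lt_iff v i).2 h), adjSwap_mul_cancel]

@[simp] theorem wordProd_nil : wordProd ([] : List (Fin (n - 1))) = 1 := rfl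

@[simp] theorem wordProd_cons (i : Fin (n - 1)) (l : List (Fin (n - 1))) :
    wordProd (i :: l) = adjSwap i * wordProd l := rfl

theorem wordProd_append (l l' : List (Fin (n - 1))) :
    wordProd (l ++ l') = wordProd l * wordProd l' := by
  simp [wordProd]

theorem wordProd_reverse (l : List (Fin (n - 1))) : wordProd l.reverse = (wordProd l)⁻¹ := by
  induction l with
  | nil => simp
  | cons i l ih => simp [wordProd_append, ih]

theorem card_inversions_wordProd_le (l : List (Fin (n - 1))) :
    (inversions (wordProd l)).card ≤ l.length := by
  induction l with
  | nil =>
    rw [wordProd_nil, List.length_nil, Nat.le_zero, Finset.card_eq_zero,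
      Finset.eq_empty_iff_forall_notMem]
    rintro ⟨p, q⟩ h
    rw [mem_inversions] at h
    exact h.1.not_gt h.2
  | cons i l ih =>
    rw [wordProd_cons, List.length_cons]
    rcases inv_lo_lt_or_gt (wordProd l) i with h | h
    · rw [card_inversions_adjSwap_mul h]; omega
    · have := card_inversions_adjSwap_mul_of_gt h; omega

/-- A function on `Fin n` that increases at every step of an interval increases on it. -/
theorem lt_of_forall_lo_lt_hi {α : Type*} [Preorder α] (f : Fin n → α) {p q : Fin n} (hpq : p < q)
    (h : ∀ i : Fin (n - 1), p ≤ lo i → lo i < q → f (lo i) < f (hi i)) : f p < f q := by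
  obtain ⟨p, hp⟩ := p
  obtain ⟨q, hq⟩ := q
  induction q with
  | zero => exact absurd hpq (by simp [Fin.lt_def])
  | succ q ih =>
    have hstep := h ⟨q, by omega⟩ (by simp [lo, Fin.le_def, Fin.lt_def] at *; omega)
      (by simp [lo, Fin.lt_def])
    rcases eq_or_lt_of_le (Nat.lt_succ_iff.1 (Fin.lt_def.1 hpq)) with h' | h'
    · subst h'; exact hstep
    · exact (ih (by omega) h' fun i h₁ h₂ => h i h₁ (h₂.trans (by simp [Fin.lt_def]))).trans hstep

theorem eq_one_of_forall_lo_lt_hi {w : Equiv.Perm (Fin n)}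
    (h : ∀ i : Fin (n - 1), w (lo i) < w (hi i)) : w = 1 := by
  have hm : StrictMono w := fun p q hpq => lt_of_forall_lo_lt_hi w hpq fun i _ _ => h i
  ext p
  have := Subsingleton.elim (hm.orderIsoOfSurjective _ w.surjective) (OrderIso.refl _)
  simpa using congrArg Fin.val (DFunLike.congr_fun this p)

theorem exists_wordProd_length (w : Equiv.Perm (Fin n)) :
    ∃ l : List (Fin (n - 1)), wordProd l = w ∧ l.length = (inversions w).card := by
  induction hk : (inversions w).card generalizing w with
  | zero =>
    refine ⟨[], ?_, rfl⟩
    rw [wordProd_nil, eq_comm, ← inv_eq_one]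
    refine eq_one_of_forall_lo_lt_hi fun i => ?_
    refine (inv_lo_lt_or_gt w i).resolve_right fun h => ?_
    have := card_inversions_adjSwap_mul_of_gt h
    omega
  | succ k ih =>
    have : ∃ i, w⁻¹ (hi i) < w⁻¹ (lo i) := by
      by_contra! hc
      have h1 : w⁻¹ = 1 := eq_one_of_forall_lo_lt_hi fun i =>
        (inv_lo_lt_or_gt w i).resolve_right (hc i).not_gt
      rw [inv_eq_one] at h1
      have := card_inversions_wordProd_le ([] : List (Fin (n - 1)))
      simp [← h1, hk] at this
    obtain ⟨i, hi⟩ := this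
    have hcard := card_inversions_adjSwap_mul_of_gt hi
    obtain ⟨l, hl, hlen⟩ := ih (adjSwap i * w) (by omega)
    exact ⟨i :: l, by simp [hl], by simp [hlen]⟩

theorem len_eq_card_inversions (w : Equiv.Perm (Fin n)) : len w = (inversions w).card := by
  obtain ⟨l, hl, hlen⟩ := exists_wordProd_length w
  refine le_antisymm (hlen ▸ (reducedWord_spec w).2 l hl) ?_
  conv_lhs => rw [← (reducedWord_spec w).1]
  exact card_inversions_wordProd_le _

theorem wordProd_reducedWord (w : Equiv.Perm (Fin n)) : wordProd (reducedWord w) = w :=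
  (reducedWord_spec w).1

theorem length_reducedWord (w : Equiv.Perm (Fin n)) : (reducedWord w).length = len w := rfl

theorem len_wordProd_le (l : List (Fin (n - 1))) : len (wordProd l) ≤ l.length :=
  (reducedWord_spec _).2 l rfl

theorem len_adjSwap_mul_of_lt {i : Fin (n - 1)} {w : Equiv.Perm (Fin n)}
    (h : w⁻¹ (lo i) < w⁻¹ (hi i)) : len (adjSwap i * w) = len w + 1 := by
  rw [len_eq_card_inversions, len_eq_card_inversions, card_inversions_adjSwap_mul h]

theorem len_adjSwap_mul_of_gt {i : Fin (n - 1)} {w : Equiv.Perm (Fin n)}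
    (h : w⁻¹ (hi i) < w⁻¹ (lo i)) : len (adjSwap i * w) + 1 = len w := by
  rw [len_eq_card_inversions, len_eq_card_inversions, card_inversions_adjSwap_mul_of_gt h]

@[simp] theorem len_inv (w : Equiv.Perm (Fin n)) : len w⁻¹ = len w := by
  have key : ∀ v : Equiv.Perm (Fin n), len v⁻¹ ≤ len v := fun v => by
    conv_lhs => rw [← wordProd_reducedWord v, ← wordProd_reverse]
    exact (len_wordProd_le _).trans (by rw [List.length_reverse, length_reducedWord])
  exact le_antisymm (key w) (by simpa using key w⁻¹)

theorem len_mul_adjSwap_of_lt {i : Fin (n - 1)} {w : Equiv.Perm (Fin n)}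
    (h : w (lo i) < w (hi i)) : len (w * adjSwap i) = len w + 1 := by
  have := len_adjSwap_mul_of_lt (i := i) (w := w⁻¹) (by simpa using h)
  rw [← len_inv (w * _), mul_inv_rev, adjSwap_inv, this, len_inv]

/-! ### Reduced words -/

theorem isReducedWord_iff {l : List (Fin (n - 1))} {w : Equiv.Perm (Fin n)} :
    IsReducedWord l w ↔ wordProd l = w ∧ l.length = len w := by
  constructor
  · rintro ⟨h₁, h₂⟩
    refine ⟨h₁, le_antisymm (h₂ _ (wordProd_reducedWord w)) ?_⟩
    rw [← h₁]; exact len_wordProd_le l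
  · rintro ⟨h₁, h₂⟩
    refine ⟨h₁, fun l' hl' => ?_⟩
    rw [h₂, ← hl']; exact len_wordProd_le l'

theorem isReducedWord_cons {i : Fin (n - 1)} {l : List (Fin (n - 1))} {w : Equiv.Perm (Fin n)} :
    IsReducedWord (i :: l) w ↔
      IsReducedWord l (adjSwap i * w) ∧ w⁻¹ (hi i) < w⁻¹ (lo i) := by
  rw [isReducedWord_iff, isReducedWord_iff, wordProd_cons, List.length_cons]
  constructor
  · rintro ⟨rfl, h₂⟩
    rw [adjSwap_mul_cancel]
    have hle := len_wordProd_le l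
    rcases inv_lo_lt_or_gt (wordProd l) i with h | h
    · rw [len_adjSwap_mul_of_lt h] at h₂
      exact ⟨⟨rfl, by omega⟩, by simpa using h⟩
    · have := len_adjSwap_mul_of_gt h; omega
  · rintro ⟨⟨h₁, h₂⟩, h₃⟩
    have := len_adjSwap_mul_of_gt h₃
    exact ⟨by rw [h₁, adjSwap_mul_cancel], by omega⟩

theorem IsReducedWord.reverse {l : List (Fin (n - 1))} {w : Equiv.Perm (Fin n)}
    (h : IsReducedWord l w) : IsReducedWord l.reverse w⁻¹ := by
  rw [isReducedWord_iff] at *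
  exact ⟨by rw [wordProd_reverse, h.1], by rw [List.length_reverse, h.2, len_inv]⟩

theorem IsReducedWord.of_append {l₁ l₂ : List (Fin (n - 1))} {w : Equiv.Perm (Fin n)}
    (h : IsReducedWord (l₁ ++ l₂) w) : IsReducedWord l₂ (wordProd l₂) := by
  induction l₁ generalizing w with
  | nil => rw [List.nil_append] at h; rwa [h.1]
  | cons i l₁ ih =>
    rw [List.cons_append, isReducedWord_cons] at h
    exact ih h.1

/-- Inversions of a suffix of a reduced word are inversions of the whole word. -/
theorem IsReducedWord.inversion_of_append {l₁ l₂ : List (Fin (n - 1))} {w : Equiv.Perm (Fin n)}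
    (h : IsReducedWord (l₁ ++ l₂) w) {p q : Fin n}
    (hpq : (p, q) ∈ inversions (wordProd l₂)) : (p, q) ∈ inversions w := by
  induction l₁ generalizing w with
  | nil => rw [List.nil_append] at h; rwa [← h.1]
  | cons i l₁ ih =>
    rw [List.cons_append, isReducedWord_cons] at h
    have hmem := ih h.1
    have := inversions_adjSwap_mul ((inv_adjSwap_mul_lt_iff w i).2 h.2)
    rw [adjSwap_mul_cancel] at this
    rw [this]
    exact Finset.mem_insert_of_mem hmem

/-- Every letter `i` of a reduced word swaps the values at two positions `p < q`, and `p, q` is an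
inversion of the whole word. -/
theorem IsReducedWord.letter {l₁ l₂ : List (Fin (n - 1))} {i : Fin (n - 1)}
    {w : Equiv.Perm (Fin n)} (h : IsReducedWord (l₁ ++ i :: l₂) w) :
    (wordProd l₂)⁻¹ (lo i) < (wordProd l₂)⁻¹ (hi i) ∧
      w ((wordProd l₂)⁻¹ (hi i)) < w ((wordProd l₂)⁻¹ (lo i)) := by
  have h₂ := h.of_append
  rw [isReducedWord_cons] at h₂
  have h₃ : (wordProd l₂)⁻¹ (lo i) < (wordProd l₂)⁻¹ (hi i) := by simpa using h₂.2
  refine ⟨h₃, (mem_inversions.1 (h.inversion_of_append ?_)).2⟩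
  rw [wordProd_cons, inversions_adjSwap_mul h₃]
  exact Finset.mem_insert_self _ _

theorem hi_eq_lo {i j : Fin (n - 1)} (h : (i : ℕ) + 1 = j) : hi i = lo j := by
  simp [hi, lo, h]

theorem adjSwap_far {i j : Fin (n - 1)} (h : (i : ℕ) + 1 < j) :
    adjSwap i (lo j) = lo j ∧ adjSwap i (hi j) = hi j ∧
      adjSwap j (lo i) = lo i ∧ adjSwap j (hi i) = hi i := by
  refine ⟨adjSwap_of_ne ?_ ?_, adjSwap_of_ne ?_ ?_, adjSwap_of_ne ?_ ?_, adjSwap_of_ne ?_ ?_⟩ <;>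
    simp [lo, hi, Fin.ext_iff] <;> omega

theorem adjSwap_succ {i j : Fin (n - 1)} (h : (i : ℕ) + 1 = j) :
    adjSwap i (hi j) = hi j ∧ adjSwap j (lo i) = lo i := by
  refine ⟨adjSwap_of_ne ?_ ?_, adjSwap_of_ne ?_ ?_⟩ <;>
    simp [lo, hi, Fin.ext_iff] <;> omega

/-- The braid relations of the symmetric group, for a family in a monoid. -/
structure BraidFamily {M : Type*} [Monoid M] (t : Fin (n - 1) → M) : Prop where
  comm : ∀ i j : Fin (n - 1), (i : ℕ) + 1 < j → t i * t j = t j * t i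
  braid : ∀ i j : Fin (n - 1), (i : ℕ) + 1 = j → t i * t j * t i = t j * t i * t j

theorem adjSwap_comm {i j : Fin (n - 1)} (h : (i : ℕ) + 1 < j) :
    adjSwap i * adjSwap j = adjSwap j * adjSwap i := by
  rw [adjSwap, adjSwap]
  refine (Equiv.Perm.Disjoint.commute ?_).eq
  intro a
  by_cases h₁ : a = lo i ∨ a = hi i
  · right
    rcases h₁ with rfl | rfl
    exacts [(adjSwap_far h).2.2.1, (adjSwap_far h).2.2.2]
  · push Not at h₁
    left; exact adjSwap_of_ne h₁.1 h₁.2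

theorem adjSwap_braid {i j : Fin (n - 1)} (h : (i : ℕ) + 1 = j) :
    adjSwap i * adjSwap j * adjSwap i = adjSwap j * adjSwap i * adjSwap j := by
  obtain ⟨h₁, h₂⟩ := adjSwap_succ h
  have h₃ : adjSwap j (hi i) = hi j := by rw [hi_eq_lo h, adjSwap_lo]
  have h₄ : adjSwap i (lo j) = lo i := by rw [← hi_eq_lo h, adjSwap_hi]
  ext a
  simp only [Equiv.Perm.mul_apply]
  by_cases ha : a = lo i
  · subst ha; simp [h₁, h₂, h₃]
  by_cases hb : a = hi i
  · subst hb; simp [h₁, h₂, h₃]; rw [hi_eq_lo h]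
  by_cases hc : a = hi j
  · subst hc; simp [h₁, h₂, ← hi_eq_lo h]
  have hb' : a ≠ lo j := hi_eq_lo h ▸ hb
  simp [adjSwap_of_ne ha hb, adjSwap_of_ne hb' hc]

/-- **Matsumoto's theorem** for the symmetric group: in a monoid, a product along a reduced word
depends only on the permutation, as soon as the braid relations hold. -/
theorem BraidFamily.prod_eq {M : Type*} [Monoid M] {t : Fin (n - 1) → M} (ht : BraidFamily t)
    {w : Equiv.Perm (Fin n)} {l l' : List (Fin (n - 1))} (h : IsReducedWord l w)
    (h' : IsReducedWord l' w) : (l.map t).prod = (l'.map t).prod := by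
  induction hk : l.length using Nat.strong_induction_on generalizing w l l' with
  | _ k ih =>
  subst hk
  have hlen : l.length = l'.length := by
    rw [(isReducedWord_iff.1 h).2, (isReducedWord_iff.1 h').2]
  match l, l', hlen with
  | [], [], _ => rfl
  | i :: l, j :: l', hlen =>
    -- The first letters may be assumed in order, `i ≤ j`.
    wlog hij : (i : ℕ) ≤ j generalizing i j l l'
    · exact (this j l' i l hlen.symm h' h (fun m hm => ih m (hlen ▸ hm)) (by omega)).symm
    have hl := isReducedWord_cons.1 h
    have hl' := isReducedWord_cons.1 h'
    simp only [List.map_cons, List.prod_cons]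
    rcases lt_trichotomy ((i : ℕ) + 1) j with hc | hc | hc
    · -- Distant letters: `w = s_i s_j v`.
      obtain ⟨m, hm⟩ := exists_isReducedWord (adjSwap j * (adjSwap i * w))
      obtain ⟨f₁, f₂, f₃, f₄⟩ := adjSwap_far hc
      have e₁ : IsReducedWord (j :: m) (adjSwap i * w) :=
        isReducedWord_cons.2 ⟨hm, by simpa [f₁, f₂] using hl'.2⟩
      have e₂ : IsReducedWord (i :: m) (adjSwap j * w) := by
        refine isReducedWord_cons.2 ⟨?_, by simpa [f₃, f₄] using hl.2⟩
        rwa [← mul_assoc, adjSwap_comm hc, mul_assoc]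
      rw [ih l.length (by simp) hl.1 e₁ rfl, ih l'.length (by simp [hlen]) hl'.1 e₂ rfl]
      simp only [List.map_cons, List.prod_cons, ← mul_assoc]
      rw [ht.comm i j hc]
    · -- Adjacent letters: `w = s_i s_j s_i v`.
      obtain ⟨m, hm⟩ := exists_isReducedWord (adjSwap i * (adjSwap j * (adjSwap i * w)))
      obtain ⟨f₁, f₂⟩ := adjSwap_succ hc
      have f₃ : adjSwap j (hi i) = hi j := by rw [hi_eq_lo hc, adjSwap_lo]
      have f₄ : adjSwap i (lo j) = lo i := by rw [← hi_eq_lo hc, adjSwap_hi]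
      have g₁ := hl.2
      have g₂ := hl'.2
      rw [← hi_eq_lo hc] at g₂
      have e₁ : IsReducedWord (j :: i :: m) (adjSwap i * w) := by
        refine isReducedWord_cons.2 ⟨isReducedWord_cons.2 ⟨hm, ?_⟩, ?_⟩
        · simpa [f₂, f₃, f₁] using g₂
        · simpa [f₁, f₄] using g₂.trans g₁
      have e₂ : IsReducedWord (i :: j :: m) (adjSwap j * w) := by
        refine isReducedWord_cons.2 ⟨isReducedWord_cons.2 ⟨?_, ?_⟩, ?_⟩
        · have hb : adjSwap i * (adjSwap j * (adjSwap i * w)) =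
              adjSwap j * (adjSwap i * (adjSwap j * w)) := by
            simpa only [mul_assoc] using congrArg (· * w) (adjSwap_braid hc)
          rwa [hb] at hm
        · simpa [f₁, f₄, f₂, hi_eq_lo hc] using g₁
        · simpa [f₂, f₃] using g₂.trans g₁
      rw [ih l.length (by simp) hl.1 e₁ rfl, ih l'.length (by simp [hlen]) hl'.1 e₂ rfl]
      simp only [List.map_cons, List.prod_cons, ← mul_assoc]
      rw [ht.braid i j hc]
    · obtain rfl : i = j := Fin.ext (by omega)
      rw [ih l.length (by simp) hl.1 hl'.1 rfl]

theorem BraidFamily.prod_reducedWord_cons {M : Type*} [Monoid M] {t : Fin (n - 1) → M}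
    (ht : BraidFamily t) {w : Equiv.Perm (Fin n)} {i : Fin (n - 1)}
    (h : w⁻¹ (lo i) < w⁻¹ (hi i)) :
    ((reducedWord (adjSwap i * w)).map t).prod = t i * ((reducedWord w).map t).prod := by
  have : IsReducedWord (i :: reducedWord w) (adjSwap i * w) :=
    isReducedWord_cons.2 ⟨by simpa using reducedWord_spec w, by simpa using h⟩
  rw [ht.prod_eq (reducedWord_spec _) this, List.map_cons, List.prod_cons]

theorem BraidFamily.prod_reducedWord_concat {M : Type*} [Monoid M] {t : Fin (n - 1) → M}
    (ht : BraidFamily t) {w : Equiv.Perm (Fin n)} {i : Fin (n - 1)}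
    (h : w (lo i) < w (hi i)) :
    ((reducedWord (w * adjSwap i)).map t).prod = ((reducedWord w).map t).prod * t i := by
  have : IsReducedWord (reducedWord w ++ [i]) (w * adjSwap i) := by
    rw [isReducedWord_iff, wordProd_append, wordProd_reducedWord, len_mul_adjSwap_of_lt h]
    simp [length_reducedWord]
  rw [ht.prod_eq (reducedWord_spec _) this]
  simp

/-! ### Longest elements of parabolic subgroups -/

theorem mem_parabolic_le_iff {J : Finset (Fin (n - 1))} {w : Equiv.Perm (Fin n)}
    (hw : w ∈ parabolic J) {k : Fin (n - 1)} (hk : k ∉ J) (a : Fin n) :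
    w a ≤ lo k ↔ a ≤ lo k := by
  induction hw using Subgroup.closure_induction generalizing a with
  | mem x hx =>
    obtain ⟨j, hj, rfl⟩ := hx
    have hjk : (j : ℕ) ≠ k := fun h => hk (Fin.ext h ▸ hj)
    simp only [adjSwap, Equiv.swap_apply_def, Fin.ext_iff, lo, hi, Fin.le_def]
    split_ifs <;> simp_all <;> omega
  | one => simp
  | mul x y _ _ hx hy => rw [Equiv.Perm.mul_apply, hx, hy]
  | inv x _ hx => rw [← hx (x⁻¹ a)]; simp

theorem adjSwap_mem_parabolic {J : Finset (Fin (n - 1))} {i : Fin (n - 1)} (hi : i ∈ J) :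
    adjSwap i ∈ parabolic J :=
  Subgroup.subset_closure ⟨i, hi, rfl⟩

theorem wordProd_mem_parabolic {J : Finset (Fin (n - 1))} {l : List (Fin (n - 1))}
    (h : ∀ i ∈ l, i ∈ J) : wordProd l ∈ parabolic J := by
  refine Subgroup.list_prod_mem _ fun x hx => ?_
  obtain ⟨i, hi, rfl⟩ := List.mem_map.1 hx
  exact adjSwap_mem_parabolic (h i hi)

/-- Reduced words of elements of a parabolic subgroup only use letters of that subgroup: the last
letter `k` outside of `J` would create an inversion across `k`. -/
theorem mem_of_mem_reducedWord {J : Finset (Fin (n - 1))} {w : Equiv.Perm (Fin n)}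
    (hw : w ∈ parabolic J) {l : List (Fin (n - 1))} (hl : IsReducedWord l w) :
    ∀ i ∈ l, i ∈ J := by
  suffices h : ∀ l₁ l₂, l₁ ++ l₂ = l → ∀ i ∈ l₂, i ∈ J from h [] l rfl
  intro l₁ l₂
  induction l₂ generalizing l₁ with
  | nil => simp
  | cons k l₂ ih =>
    intro h
    have hl₂ := ih (l₁ ++ [k]) (by simpa using h)
    refine List.forall_mem_cons.2 ⟨?_, hl₂⟩
    by_contra hk
    have hv := (parabolic J).inv_mem (wordProd_mem_parabolic hl₂)
    subst h
    have h₁ : (wordProd l₂)⁻¹ (lo k) ≤ lo k := (mem_parabolic_le_iff hv hk _).2 le_rfl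
    have h₂ : ¬(wordProd l₂)⁻¹ (hi k) ≤ lo k := by
      rw [mem_parabolic_le_iff hv hk]; exact (lo_lt_hi k).not_ge
    rw [← mem_parabolic_le_iff hw hk] at h₁ h₂
    exact h₂ (hl.letter.2.le.trans h₁)

theorem mem_of_mem_reducedWord_longest {J : Finset (Fin (n - 1))} :
    ∀ i ∈ reducedWord (longest J), i ∈ J :=
  mem_of_mem_reducedWord (longest_spec J).1 (reducedWord_spec _)

theorem subset_descents_longest (J : Finset (Fin (n - 1))) : J ⊆ descents (longest J) := by
  intro i hiJ
  rw [mem_descents]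
  by_contra h
  have hlt : longest J (lo i) < longest J (hi i) :=
    lt_of_le_of_ne (not_lt.1 h) fun h => lo_ne_hi i ((longest J).injective h)
  have := (longest_spec J).2 _
    ((parabolic J).mul_mem (longest_spec J).1 (adjSwap_mem_parabolic hiJ))
  rw [len_mul_adjSwap_of_lt hlt] at this
  omega

theorem longest_left_descent {J : Finset (Fin (n - 1))} {i : Fin (n - 1)} (hiJ : i ∈ J) :
    (longest J)⁻¹ (hi i) < (longest J)⁻¹ (lo i) := by
  refine (inv_lo_lt_or_gt _ i).resolve_left fun hlt => ?_
  have := (longest_spec J).2 _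
    ((parabolic J).mul_mem (adjSwap_mem_parabolic hiJ) (longest_spec J).1)
  rw [len_adjSwap_mul_of_lt hlt] at this
  omega

end Perm

/-! ### Relations between the Demazure operators -/

section Demazure

variable (F : Type*) [Field F] {n : ℕ}

theorem rename_rename_adjSwap (i : Fin (n - 1)) (f : MvPolynomial (Fin n) F) :
    rename (adjSwap i) (rename (adjSwap i) f) = f := by
  have : (adjSwap i ∘ adjSwap i : Fin n → Fin n) = id := funext fun a => adjSwap_apply_apply i a
  rw [rename_rename, this, rename_id_apply]

theorem demazureBar_apply (i : Fin (n - 1)) (f : MvPolynomial (Fin n) F) :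
    demazureBar F i f = demazure F i f - f := rfl

theorem demazure_spec (i : Fin (n - 1)) (f : MvPolynomial (Fin n) F) :
    (X (lo i) - X (hi i)) * demazure F i f = X (lo i) * f - X (hi i) * rename (adjSwap i) f :=
  demazureFun_spec F i f

theorem demazureBar_spec (i : Fin (n - 1)) (f : MvPolynomial (Fin n) F) :
    (X (lo i) - X (hi i)) * demazureBar F i f = X (hi i) * (f - rename (adjSwap i) f) := by
  rw [demazureBar_apply, mul_sub, demazure_spec]; ring

theorem rename_demazure (i : Fin (n - 1)) (f : MvPolynomial (Fin n) F) :
    rename (adjSwap i) (demazure F i f) = demazure F i f := by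
  apply mul_left_cancel₀ (X_sub_X_ne_zero F i)
  have h := congrArg (rename (adjSwap i)) (demazure_spec F i f)
  simp only [map_mul, map_sub, rename_X, adjSwap_lo, adjSwap_hi, rename_rename_adjSwap] at h
  linear_combination -h - demazure_spec F i f

/-- `π̄_i` is linear over the polynomials symmetric in `x_i` and `x_{i+1}`. -/
theorem demazureBar_mul {i : Fin (n - 1)} {m : MvPolynomial (Fin n) F}
    (hm : rename (adjSwap i) m = m) (f : MvPolynomial (Fin n) F) :
    demazureBar F i (m * f) = m * demazureBar F i f := by
  apply mul_left_cancel₀ (X_sub_X_ne_zero F i)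
  rw [demazureBar_spec, map_mul, hm]
  linear_combination -m * demazureBar_spec F i f

theorem demazureBar_eq_zero {i : Fin (n - 1)} {f : MvPolynomial (Fin n) F}
    (hf : rename (adjSwap i) f = f) : demazureBar F i f = 0 := by
  apply mul_left_cancel₀ (X_sub_X_ne_zero F i)
  rw [demazureBar_spec, hf, sub_self, mul_zero, mul_zero]

theorem demazure_mul_self (i : Fin (n - 1)) : demazure F i * demazure F i = demazure F i := by
  refine LinearMap.ext fun f => mul_left_cancel₀ (X_sub_X_ne_zero F i) ?_
  rw [Module.End.mul_apply, demazure_spec, rename_demazure]; ring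

theorem demazureBar_mul_self (i : Fin (n - 1)) :
    demazureBar F i * demazureBar F i = -demazureBar F i := by
  have h := demazure_mul_self F i
  simp only [demazureBar, sub_mul, mul_sub, one_mul, mul_one, h]
  abel

theorem demazure_comm {i j : Fin (n - 1)} (h : (i : ℕ) + 1 < j) :
    demazure F i * demazure F j = demazure F j * demazure F i := by
  refine LinearMap.ext fun f => mul_left_cancel₀
    (mul_ne_zero (X_sub_X_ne_zero F i) (X_sub_X_ne_zero F j)) ?_
  obtain ⟨h₁, h₂, h₃, h₄⟩ := adjSwap_far h
  have hc : rename (adjSwap i) (rename (adjSwap j) f) =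
      rename (adjSwap j) (rename (adjSwap i) f) := by
    rw [rename_rename, rename_rename, ← Equiv.Perm.coe_mul, adjSwap_comm h, Equiv.Perm.coe_mul]
  have e₁ := demazure_spec F i (demazure F j f)
  have e₂ := demazure_spec F j (demazure F i f)
  have e₃ := demazure_spec F i f
  have e₄ := demazure_spec F j f
  have e₅ := congrArg (rename (adjSwap j)) e₃
  have e₆ := congrArg (rename (adjSwap i)) e₄
  simp only [map_mul, map_sub, rename_X, h₁, h₂, h₃, h₄, hc] at e₅ e₆
  simp only [Module.End.mul_apply]
  linear_combination (X (lo j) - X (hi j)) * e₁ - (X (lo i) - X (hi i)) * e₂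
    + X (lo i) * e₄ - X (hi i) * e₆ - X (lo j) * e₃ + X (hi j) * e₅

theorem X_lo_sub_X_ne_zero {i j : Fin (n - 1)} (h : (i : ℕ) + 1 = j) :
    (X (lo i) - X (hi j) : MvPolynomial (Fin n) F) ≠ 0 := by
  rw [sub_ne_zero]
  intro h'
  have := X_injective (σ := Fin n) (R := F) h'
  simp [lo, hi] at this
  omega

theorem demazure_braid {i j : Fin (n - 1)} (h : (i : ℕ) + 1 = j) :
    demazure F i * demazure F j * demazure F i = demazure F j * demazure F i * demazure F j := by
  refine LinearMap.ext fun f => mul_left_cancel₀ (mul_ne_zero (mul_ne_zero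
    (X_sub_X_ne_zero F i) (X_sub_X_ne_zero F j)) (X_lo_sub_X_ne_zero F h)) ?_
  simp only [Module.End.mul_apply]
  obtain ⟨h₁, h₂⟩ := adjSwap_succ h
  have h₃ : adjSwap j (hi i) = hi j := by rw [hi_eq_lo h, adjSwap_lo]
  have hb : rename (adjSwap i) (rename (adjSwap j) (rename (adjSwap i) f)) =
      rename (adjSwap j) (rename (adjSwap i) (rename (adjSwap j) f)) := by
    simp only [rename_rename, ← Equiv.Perm.coe_mul, ← mul_assoc, adjSwap_braid h]
  have a₁ := demazure_spec F i f
  have a₂ := congrArg (rename (adjSwap j)) a₁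
  have a₃ := congrArg (rename (adjSwap i)) a₂
  have b₁ := demazure_spec F j (demazure F i f)
  have b₂ := congrArg (rename (adjSwap i)) b₁
  have c := demazure_spec F i (demazure F j (demazure F i f))
  have a₁' := demazure_spec F j f
  have a₂' := congrArg (rename (adjSwap i)) a₁'
  have a₃' := congrArg (rename (adjSwap j)) a₂'
  have b₁' := demazure_spec F i (demazure F j f)
  have b₂' := congrArg (rename (adjSwap j)) b₁'
  have c' := demazure_spec F j (demazure F i (demazure F j f))
  simp only [map_mul, map_sub, rename_X, h₁, h₂, h₃, ← hi_eq_lo h, adjSwap_lo, adjSwap_hi, hb,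
    rename_demazure] at a₁ a₂ a₃ b₁ b₂ c a₁' a₂' a₃' b₁' b₂' c' ⊢
  set x : MvPolynomial (Fin n) F := X (lo i)
  set y : MvPolynomial (Fin n) F := X (hi i)
  set z : MvPolynomial (Fin n) F := X (hi j)
  -- Both sides, multiplied by the Vandermonde product, expand to the same signed sum over `S₃`.
  linear_combination (x - z) * (y - z) * c + x * (x - z) * b₁ - y * (y - z) * b₂
    + x * y * a₁ - x * z * a₂ + y * z * a₃
    - ((x - y) * (x - z) * c' + y * (x - z) * b₁' - z * (x - y) * b₂'
    + x ^ 2 * a₁' - y ^ 2 * a₂' + z ^ 2 * a₃')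

theorem braidFamily_demazureBar : BraidFamily (demazureBar F (n := n)) where
  comm i j h := by
    have hc := demazure_comm F h
    simp only [demazureBar, sub_mul, mul_sub, hc, one_mul, mul_one]
    abel
  braid i j h := by
    have key : ∀ a b : Module.End F (MvPolynomial (Fin n) F), a * a = a →
        (a - 1) * (b - 1) * (a - 1) = a * b * a - a * b - b * a + a + b - 1 := by
      intro a b ha
      simp only [sub_mul, mul_sub, one_mul, mul_one, ha]
      abel
    rw [demazureBar, demazureBar, key _ _ (demazure_mul_self F i), key _ _ (demazure_mul_self F j),
      demazure_braid F h]
    abel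

/-! ### Demazure operators on monomials -/

theorem rename_adjSwap_monomial {i : Fin (n - 1)} {c : Fin n →₀ ℕ} (hc : c (lo i) = c (hi i)) :
    rename (adjSwap i) (monomial c (1 : F)) = monomial c 1 := by
  rw [rename_monomial]
  congr 2
  ext a
  conv_lhs => rw [← adjSwap_apply_apply i a]
  rw [Finsupp.mapDomain_apply (adjSwap i).injective]
  by_cases h₁ : a = lo i
  · subst h₁; rw [adjSwap_lo, hc]
  by_cases h₂ : a = hi i
  · subst h₂; rw [adjSwap_hi, hc]
  rw [adjSwap_of_ne h₁ h₂]

/-- Every exponent is, up to a part symmetric in `i` and `i + 1`, a power of `x_i` or of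
`x_{i+1}`. -/
theorem exists_eq_add_single (i : Fin (n - 1)) (a : Fin n →₀ ℕ) :
    ∃ (c : Fin n →₀ ℕ) (p : ℕ), c (lo i) = c (hi i) ∧
      (a = c + Finsupp.single (lo i) p ∨ a = c + Finsupp.single (hi i) p) := by
  rcases le_total (a (hi i)) (a (lo i)) with h | h
  · refine ⟨a - Finsupp.single (lo i) (a (lo i) - a (hi i)), a (lo i) - a (hi i), ?_, Or.inl ?_⟩
    · simp [(lo_ne_hi i)]; omega
    · rw [tsub_add_cancel_of_le]; simp
  · refine ⟨a - Finsupp.single (hi i) (a (hi i) - a (lo i)), a (hi i) - a (lo i), ?_, Or.inr ?_⟩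
    · simp [(lo_ne_hi i).symm]; omega
    · rw [tsub_add_cancel_of_le]; simp

theorem demazureBar_X_pow (i : Fin (n - 1)) (p : ℕ) :
    demazureBar F i (X (lo i) ^ p) =
      ∑ j ∈ Finset.range p, X (lo i) ^ j * X (hi i) ^ (p - j) := by
  apply mul_left_cancel₀ (X_sub_X_ne_zero F i)
  rw [demazureBar_spec, map_pow, rename_X, adjSwap_lo, ← (Commute.all _ _).geom_sum₂_mul,
    Finset.sum_mul, Finset.mul_sum, Finset.mul_sum]
  refine Finset.sum_congr rfl fun j hj => ?_
  rw [Finset.mem_range] at hj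
  obtain ⟨q, rfl⟩ : ∃ q, p = j + 1 + q := ⟨p - (j + 1), by omega⟩
  rw [show j + 1 + q - 1 - j = q by omega, show j + 1 + q - j = q + 1 by omega]
  ring

theorem demazureBar_monomial_lo {i : Fin (n - 1)} {c : Fin n →₀ ℕ} (hc : c (lo i) = c (hi i))
    (p : ℕ) : demazureBar F i (monomial (c + Finsupp.single (lo i) p) 1) =
      ∑ j ∈ Finset.range p,
        monomial (c + Finsupp.single (lo i) j + Finsupp.single (hi i) (p - j)) 1 := by
  rw [← one_mul (1 : F), ← monomial_mul, ← X_pow_eq_monomial,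
    demazureBar_mul F (rename_adjSwap_monomial F hc), demazureBar_X_pow, Finset.mul_sum]
  refine Finset.sum_congr rfl fun j _ => ?_
  rw [X_pow_eq_monomial, X_pow_eq_monomial, monomial_mul, monomial_mul]
  simp [add_assoc]

theorem demazureBar_monomial_hi {i : Fin (n - 1)} {c : Fin n →₀ ℕ} (hc : c (lo i) = c (hi i))
    (p : ℕ) : demazureBar F i (monomial (c + Finsupp.single (hi i) p) 1) =
      -∑ j ∈ Finset.range p,
        monomial (c + Finsupp.single (lo i) j + Finsupp.single (hi i) (p - j)) 1 := by
  rw [← demazureBar_monomial_lo F hc, ← add_eq_zero_iff_eq_neg, ← map_add,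
    ← mul_one (1 : F), ← monomial_mul, ← monomial_mul, ← mul_add,
    demazureBar_mul F (rename_adjSwap_monomial F hc), demazureBar_eq_zero, mul_zero]
  rw [← X_pow_eq_monomial, ← X_pow_eq_monomial]
  simp [add_comm]

/-- Coefficients of `π̄_i f`, expanded over the monomials of `f`. -/
theorem coeff_demazureBar (i : Fin (n - 1)) (f : MvPolynomial (Fin n) F) (b : Fin n →₀ ℕ) :
    coeff b (demazureBar F i f) =
      ∑ a ∈ f.support, coeff a f * coeff b (demazureBar F i (monomial a 1)) := by
  conv_lhs => rw [f.as_sum]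
  rw [map_sum, coeff_sum]
  refine Finset.sum_congr rfl fun a _ => ?_
  rw [show monomial a (coeff a f) = coeff a f • monomial a (1 : F) by simp [smul_monomial],
    map_smul, coeff_smul, smul_eq_mul]

/-- The monomials of `π̄_i x^a`: the symmetric part of `a` together with a proper redistribution of
the remaining power of `x_i` or `x_{i+1}`. -/
theorem exists_of_coeff_demazureBar_ne_zero {i : Fin (n - 1)} {f : MvPolynomial (Fin n) F}
    {b : Fin n →₀ ℕ} (h : coeff b (demazureBar F i f) ≠ 0) :
    ∃ (c : Fin n →₀ ℕ) (p j : ℕ), c (lo i) = c (hi i) ∧ j < p ∧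
      b = c + Finsupp.single (lo i) j + Finsupp.single (hi i) (p - j) ∧
      (coeff (c + Finsupp.single (lo i) p) f ≠ 0 ∨ coeff (c + Finsupp.single (hi i) p) f ≠ 0) := by
  rw [coeff_demazureBar] at h
  obtain ⟨a, -, ha⟩ := Finset.exists_ne_zero_of_sum_ne_zero h
  obtain ⟨c, p, hc, h' | h'⟩ := exists_eq_add_single i a
  · subst h'
    have h₂ := right_ne_zero_of_mul ha
    rw [demazureBar_monomial_lo F hc, coeff_sum] at h₂
    obtain ⟨j, hj, hb⟩ := Finset.exists_ne_zero_of_sum_ne_zero h₂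
    rw [coeff_monomial, ite_ne_right_iff] at hb
    exact ⟨c, p, j, hc, Finset.mem_range.1 hj, hb.1.symm, Or.inl (left_ne_zero_of_mul ha)⟩
  · subst h'
    have h₂ := right_ne_zero_of_mul ha
    rw [demazureBar_monomial_hi F hc, coeff_neg, neg_ne_zero, coeff_sum] at h₂
    obtain ⟨j, hj, hb⟩ := Finset.exists_ne_zero_of_sum_ne_zero h₂
    rw [coeff_monomial, ite_ne_right_iff] at hb
    exact ⟨c, p, j, hc, Finset.mem_range.1 hj, hb.1.symm, Or.inr (left_ne_zero_of_mul ha)⟩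

end Demazure

/-! ### Exponents dominated by a partition, and top coefficients -/

section Top

variable {n : ℕ}

/-- The partial sum `lam₁ + ⋯ + lamₖ`. -/
def psum (lam : Fin n → ℕ) (k : ℕ) : ℕ :=
  ∑ p ∈ Finset.univ.filter fun p : Fin n => (p : ℕ) < k, lam p

theorem psum_add (lam nu : Fin n → ℕ) (k : ℕ) : psum (lam + nu) k = psum lam k + psum nu k :=
  Finset.sum_add_distrib

theorem psum_succ (lam : Fin n → ℕ) (p : Fin n) : psum lam (p + 1) = psum lam p + lam p := by
  rw [psum, psum, add_comm (Finset.sum _ _), ← Finset.sum_insert (by simp)]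
  congr 1
  ext q
  simp [Fin.ext_iff]
  omega

theorem eq_of_psum_eq {lam nu : Fin n → ℕ} (h : ∀ k ≤ n, psum lam k = psum nu k) : lam = nu := by
  funext p
  have h₁ := h p p.2.le
  have h₂ := h (p + 1) p.2
  rw [psum_succ, psum_succ] at h₂
  omega

theorem card_filter_lt (k : ℕ) :
    (Finset.univ.filter fun p : Fin n => (p : ℕ) < k).card = min k n := by
  have h : (Finset.univ.filter fun p : Fin n => (p : ℕ) < k).map Fin.valEmbedding =
      Finset.range (min k n) := by
    ext a
    simp only [Finset.mem_map, Finset.mem_filter, Finset.mem_univ, true_and,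
      Fin.valEmbedding_apply, Finset.mem_range, lt_min_iff]
    exact ⟨fun ⟨p, hp, hpa⟩ => hpa ▸ ⟨hp, p.2⟩, fun h => ⟨⟨a, h.2⟩, h.1, rfl⟩⟩
  rw [← Finset.card_map, h, Finset.card_range]

/-- The exponent `a` is dominated by `lam`: the sum of any `k` entries of `a` is at most
`lam₁ + ⋯ + lamₖ`. -/
def Dominated (a : Fin n →₀ ℕ) (lam : Fin n → ℕ) : Prop :=
  ∀ S : Finset (Fin n), ∑ p ∈ S, a p ≤ psum lam S.card

theorem Dominated.add {a b : Fin n →₀ ℕ} {lam nu : Fin n → ℕ} (ha : Dominated a lam)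
    (hb : Dominated b nu) : Dominated (a + b) (lam + nu) := fun S => by
  simp only [Finsupp.add_apply, Finset.sum_add_distrib, psum_add]
  exact add_le_add (ha S) (hb S)

theorem Dominated.perm {a a' : Fin n →₀ ℕ} {lam : Fin n → ℕ} (ha : Dominated a lam)
    (u : Equiv.Perm (Fin n)) (h : ∀ p, a' p = a (u p)) : Dominated a' lam := fun S => by
  have := ha (S.map u.toEmbedding)
  rw [Finset.sum_map, Finset.card_map] at this
  simpa [h] using this

theorem Dominated.psum_le {a : Fin n →₀ ℕ} {lam : Fin n → ℕ} (ha : Dominated a lam)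
    (u : Equiv.Perm (Fin n)) {k : ℕ} (hk : k ≤ n) : psum (a ∘ u) k ≤ psum lam k := by
  have := ha ((Finset.univ.filter fun p : Fin n => (p : ℕ) < k).map u.toEmbedding)
  rwa [Finset.sum_map, Finset.card_map, card_filter_lt, min_eq_left hk] at this

/-- The exponent of `u(x^lam)`, whose entry at position `u(p)` is `lam p`. -/
def permExp (u : Equiv.Perm (Fin n)) (lam : Fin n → ℕ) : Fin n →₀ ℕ :=
  Finsupp.equivFunOnFinite.symm fun a => lam (u⁻¹ a)

@[simp] theorem permExp_apply (u : Equiv.Perm (Fin n)) (lam : Fin n → ℕ) (a : Fin n) :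
    permExp u lam a = lam (u⁻¹ a) := rfl

theorem permExp_comp (u : Equiv.Perm (Fin n)) (lam : Fin n → ℕ) : permExp u lam ∘ u = lam := by
  funext p; simp

theorem permExp_add (u : Equiv.Perm (Fin n)) (lam nu : Fin n → ℕ) :
    permExp u (lam + nu) = permExp u lam + permExp u nu := by
  ext a; simp

theorem eq_permExp {a : Fin n →₀ ℕ} {u : Equiv.Perm (Fin n)} {lam : Fin n → ℕ}
    (h : ∀ k ≤ n, psum (a ∘ u) k = psum lam k) : a = permExp u lam := by
  have := eq_of_psum_eq h
  ext p
  simp [← this]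

theorem permExp_adjSwap_mul_eq_iff {i : Fin (n - 1)} {u v : Equiv.Perm (Fin n)}
    {lam : Fin n → ℕ} :
    permExp (adjSwap i * u) lam = permExp v lam ↔ permExp u lam = permExp (adjSwap i * v) lam := by
  simp only [Finsupp.ext_iff, permExp_apply, mul_inv_rev, adjSwap_inv, Equiv.Perm.mul_apply]
  constructor <;>
  · intro h a
    have := h (adjSwap i a)
    rw [adjSwap_apply_apply] at this
    exact this

variable {F : Type*} [Field F]

/-- `f` involves only exponents dominated by `lam`, and its coefficient at `u(x^lam)` is `τ u`.
These coefficients are multiplicative, and the operators `π̄_i` act on them by a simple rule. -/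
structure HasTop (f : MvPolynomial (Fin n) F) (lam : Fin n → ℕ)
    (τ : Equiv.Perm (Fin n) → F) : Prop where
  dominated : ∀ a, coeff a f ≠ 0 → Dominated a lam
  coeff_eq : ∀ u, coeff (permExp u lam) f = τ u

theorem HasTop.one : HasTop (1 : MvPolynomial (Fin n) F) 0 1 where
  dominated a ha := by
    rw [coeff_one, ite_ne_right_iff] at ha
    rw [← ha.1]
    intro S
    simp
  coeff_eq u := by
    rw [coeff_one, if_pos]
    · rfl
    · ext; simp

/-- Top coefficients are multiplicative: if exponents dominated by `lam` and by `nu` add up to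
a rearrangement of `lam + nu`, all the inequalities for the partial sums are equalities. -/
theorem HasTop.mul {f g : MvPolynomial (Fin n) F} {lam nu : Fin n → ℕ}
    {τ τ' : Equiv.Perm (Fin n) → F} (hf : HasTop f lam τ) (hg : HasTop g nu τ') :
    HasTop (f * g) (lam + nu) (τ * τ') where
  dominated a ha := by
    classical
    rw [coeff_mul] at ha
    obtain ⟨⟨b, b'⟩, hb, h⟩ := Finset.exists_ne_zero_of_sum_ne_zero ha
    rw [← Finset.HasAntidiagonal.mem_antidiagonal.1 hb]
    exact (hf.dominated b (left_ne_zero_of_mul h)).add (hg.dominated b' (right_ne_zero_of_mul h))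
  coeff_eq u := by
    classical
    rw [coeff_mul, Finset.sum_eq_single (permExp u lam, permExp u nu), hf.coeff_eq, hg.coeff_eq]
    · rfl
    · rintro ⟨b, b'⟩ hb hne
      by_contra h
      have h₁ := hf.dominated b (left_ne_zero_of_mul h)
      have h₂ := hg.dominated b' (right_ne_zero_of_mul h)
      have hsum : ∀ k, psum (b ∘ u) k + psum (b' ∘ u) k = psum lam k + psum nu k := by
        intro k
        rw [← psum_add, ← psum_add, ← permExp_comp u (lam + nu),
          ← Finset.HasAntidiagonal.mem_antidiagonal.1 hb]
        rfl
      refine hne (Prod.ext (eq_permExp fun k hk => ?_) (eq_permExp fun k hk => ?_)) <;>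
      · have e₁ := h₁.psum_le u hk
        have e₂ := h₂.psum_le u hk
        have e₃ := hsum k
        dsimp only
        omega
    · intro h
      exact absurd (Finset.HasAntidiagonal.mem_antidiagonal.2 (permExp_add u lam nu).symm) h

theorem HasTop.pow {f : MvPolynomial (Fin n) F} {lam : Fin n → ℕ}
    (hf : HasTop f lam 1) (k : ℕ) : HasTop (f ^ k) (k • lam) 1 := by
  induction k with
  | zero => simpa using HasTop.one
  | succ k ih => 
    rw [pow_succ, succ_nsmul]
    simpa using ih.mul hf

theorem HasTop.prod {ι : Type*} (s : Finset ι) {f : ι → MvPolynomial (Fin n) F}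
    {lam : ι → Fin n → ℕ} (hf : ∀ i ∈ s, HasTop (f i) (lam i) 1) :
    HasTop (∏ i ∈ s, f i) (∑ i ∈ s, lam i) 1 := by
  classical
  induction s using Finset.induction_on with
  | empty => simpa using HasTop.one
  | insert i s hi ih =>
    rw [Finset.prod_insert hi, Finset.sum_insert hi]
    simpa using (hf i (Finset.mem_insert_self i s)).mul
      (ih fun j hj => hf j (Finset.mem_insert_of_mem hj))

/-! ### Top coefficients and Demazure operators -/

theorem add_single_lo_apply {i : Fin (n - 1)} {c : Fin n →₀ ℕ} (hc : c (lo i) = c (hi i)) (p : ℕ)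
    (a : Fin n) :
    (c + Finsupp.single (lo i) p) a = (c + Finsupp.single (hi i) p) (adjSwap i a) := by
  by_cases h₁ : a = lo i
  · subst h₁; simp [hc]
  by_cases h₂ : a = hi i
  · subst h₂; simp [hc, lo_ne_hi, (lo_ne_hi i).symm]
  · rw [adjSwap_of_ne h₁ h₂]
    simp [Ne.symm h₁, Ne.symm h₂]

theorem Dominated.swap_single {i : Fin (n - 1)} {c : Fin n →₀ ℕ} {p : ℕ} {lam : Fin n → ℕ}
    (hc : c (lo i) = c (hi i))
    (h : Dominated (c + Finsupp.single (lo i) p) lam ∨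
      Dominated (c + Finsupp.single (hi i) p) lam) :
    Dominated (c + Finsupp.single (lo i) p) lam ∧ Dominated (c + Finsupp.single (hi i) p) lam := by
  have key := add_single_lo_apply hc p
  rcases h with h | h
  · exact ⟨h, h.perm (adjSwap i) fun a => by rw [key, adjSwap_apply_apply]⟩
  · exact ⟨h.perm (adjSwap i) key, h⟩

theorem Dominated.between {i : Fin (n - 1)} {c : Fin n →₀ ℕ} {p j : ℕ} {lam : Fin n → ℕ}
    (h₁ : Dominated (c + Finsupp.single (lo i) p) lam)
    (h₂ : Dominated (c + Finsupp.single (hi i) p) lam) (hj : j ≤ p) :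
    Dominated (c + Finsupp.single (lo i) j + Finsupp.single (hi i) (p - j)) lam := fun S => by
  have e₁ := h₁ S
  have e₂ := h₂ S
  simp only [Finsupp.add_apply, Finset.sum_add_distrib, Finsupp.single_apply,
    Finset.sum_ite_eq] at *
  split_ifs at * <;> omega

/-- A strictly balanced redistribution is dominated but is not a rearrangement of `lam`: some
initial segment of the rearrangement would separate `i` and `i + 1`. -/
theorem between_ne_permExp {i : Fin (n - 1)} {c : Fin n →₀ ℕ} {p j : ℕ} {lam : Fin n → ℕ}
    (h₁ : Dominated (c + Finsupp.single (lo i) p) lam)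
    (h₂ : Dominated (c + Finsupp.single (hi i) p) lam) (hj₀ : j ≠ 0) (hj : j < p)
    (u : Equiv.Perm (Fin n)) :
    c + Finsupp.single (lo i) j + Finsupp.single (hi i) (p - j) ≠ permExp u lam := by
  intro hb
  set k : ℕ := min ((u⁻¹ (lo i) : Fin n) : ℕ) ((u⁻¹ (hi i) : Fin n) : ℕ) + 1 with hk
  have hne : ((u⁻¹ (lo i) : Fin n) : ℕ) ≠ (u⁻¹ (hi i) : Fin n) := fun h =>
    lo_ne_hi i (u⁻¹.injective (Fin.ext h))
  have hkn : k ≤ n := by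
    have := (u⁻¹ (lo i)).2
    omega
  set S := (Finset.univ.filter fun p : Fin n => (p : ℕ) < k).map u.toEmbedding with hS
  have hmem : ∀ a, a ∈ S ↔ (u⁻¹ a : ℕ) < k := by
    intro a
    simp only [hS, Finset.mem_map, Finset.mem_filter, Finset.mem_univ, true_and,
      Equiv.coe_toEmbedding]
    exact ⟨fun ⟨b, hb, hba⟩ => by simpa [← hba] using hb, fun h => ⟨u⁻¹ a, h, by simp⟩⟩
  have hcard : S.card = k := by
    rw [hS, Finset.card_map, card_filter_lt, min_eq_left hkn]
  have hsum : ∑ a ∈ S, permExp u lam a = psum lam k := by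
    rw [hS, Finset.sum_map, psum]
    simp
  have e₁ := h₁ S
  have e₂ := h₂ S
  rw [← hb] at hsum
  simp only [Finsupp.add_apply, Finset.sum_add_distrib, Finsupp.single_apply,
    Finset.sum_ite_eq, hmem, hcard] at e₁ e₂ hsum
  split_ifs at * <;> omega

theorem sum_coeff_between {i : Fin (n - 1)} {c : Fin n →₀ ℕ} {p : ℕ} {lam : Fin n → ℕ}
    (hc : c (lo i) = c (hi i))
    (h₁ : Dominated (c + Finsupp.single (lo i) p) lam)
    (h₂ : Dominated (c + Finsupp.single (hi i) p) lam) (u : Equiv.Perm (Fin n)) :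
    (∑ j ∈ Finset.range p, coeff (permExp u lam)
      (monomial (c + Finsupp.single (lo i) j + Finsupp.single (hi i) (p - j)) (1 : F))) =
      if lam (u⁻¹ (lo i)) < lam (u⁻¹ (hi i)) ∧ c + Finsupp.single (hi i) p = permExp u lam
        then 1 else 0 := by
  classical
  rcases Nat.eq_zero_or_pos p with rfl | hp
  · rw [Finset.range_zero, Finset.sum_empty, if_neg]
    rintro ⟨hlt, heq⟩
    rw [← permExp_apply u lam, ← permExp_apply u lam, ← heq] at hlt
    simp [hc] at hlt
  · rw [Finset.sum_eq_single 0]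
    · simp only [Finsupp.single_zero, add_zero, tsub_zero, coeff_monomial]
      refine if_congr ⟨fun h => ⟨?_, h⟩, fun h => h.2⟩ rfl rfl
      rw [← permExp_apply u lam, ← permExp_apply u lam, ← h]
      simp [hc, (lo_ne_hi i).symm, hp]
    · intro j hj hj₀
      rw [coeff_monomial, if_neg]
      exact between_ne_permExp h₁ h₂ hj₀ (Finset.mem_range.1 hj) u
    · intro h
      exact absurd (Finset.mem_range.2 hp) h

theorem coeff_permExp_demazureBar_monomial {i : Fin (n - 1)} {a : Fin n →₀ ℕ} {lam : Fin n → ℕ}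
    (ha : Dominated a lam) (u : Equiv.Perm (Fin n)) :
    coeff (permExp u lam) (demazureBar F i (monomial a 1)) =
      if lam (u⁻¹ (lo i)) < lam (u⁻¹ (hi i)) then
        (if a = permExp (adjSwap i * u) lam then 1 else 0) - (if a = permExp u lam then 1 else 0)
      else 0 := by
  classical
  have hsu : ∀ b, permExp (adjSwap i * u) lam b = permExp u lam (adjSwap i b) := by
    intro b; simp
  obtain ⟨c, p, hc, rfl | rfl⟩ := exists_eq_add_single i a
  · obtain ⟨h₁, h₂⟩ := Dominated.swap_single hc (Or.inl ha)
    rw [demazureBar_monomial_lo F hc, coeff_sum, sum_coeff_between hc h₁ h₂, ite_and]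
    by_cases hlt : lam (u⁻¹ (lo i)) < lam (u⁻¹ (hi i))
    · have hne : c + Finsupp.single (lo i) p ≠ permExp u lam := by
        intro h
        rw [← permExp_apply u lam, ← permExp_apply u lam, ← h] at hlt
        simp [hc, lo_ne_hi] at hlt
      rw [if_pos hlt, if_pos hlt, if_neg hne, sub_zero]
      refine if_congr ⟨fun h => Finsupp.ext fun a => ?_, fun h => Finsupp.ext fun a => ?_⟩ rfl rfl
      · rw [hsu, ← h, add_single_lo_apply hc]
      · rw [← adjSwap_apply_apply i a, ← add_single_lo_apply hc, h, hsu]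
    · rw [if_neg hlt, if_neg hlt]
  · obtain ⟨h₁, h₂⟩ := Dominated.swap_single hc (Or.inr ha)
    rw [demazureBar_monomial_hi F hc, coeff_neg, coeff_sum, sum_coeff_between hc h₁ h₂, ite_and]
    by_cases hlt : lam (u⁻¹ (lo i)) < lam (u⁻¹ (hi i))
    · have hne : c + Finsupp.single (hi i) p ≠ permExp (adjSwap i * u) lam := by
        intro h
        have e₁ := DFunLike.congr_fun h (lo i)
        have e₂ := DFunLike.congr_fun h (hi i)
        rw [hsu, adjSwap_lo, permExp_apply] at e₁
        rw [hsu, adjSwap_hi, permExp_apply] at e₂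
        simp [hc, (lo_ne_hi i).symm] at e₁ e₂ hlt
        omega
      rw [if_pos hlt, if_pos hlt, if_neg hne, zero_sub]
    · rw [if_neg hlt, if_neg hlt, neg_zero]

/-- The coefficient of `π̄_i f` at an extreme exponent `b` vanishes unless `b_i < b_{i+1}`, and is
then the difference of the coefficients of `f` at `s_i b` and at `b`. -/
theorem HasTop.demazureBar {f : MvPolynomial (Fin n) F} {lam : Fin n → ℕ}
    {τ : Equiv.Perm (Fin n) → F} (hf : HasTop f lam τ) (i : Fin (n - 1)) :
    HasTop (ZeroHecke.demazureBar F i f) lam fun u =>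
      if lam (u⁻¹ (lo i)) < lam (u⁻¹ (hi i)) then τ (adjSwap i * u) - τ u else 0 where
  dominated b hb := by
    obtain ⟨c, p, j, hc, hj, rfl, h⟩ := exists_of_coeff_demazureBar_ne_zero F hb
    obtain ⟨h₁, h₂⟩ := Dominated.swap_single hc (h.imp (hf.dominated _) (hf.dominated _))
    exact h₁.between h₂ hj.le
  coeff_eq u := by
    classical
    rw [coeff_demazureBar, Finset.sum_congr rfl fun a ha => by
      rw [coeff_permExp_demazureBar_monomial (hf.dominated a (mem_support_iff.1 ha))]]
    split_ifs with h
    · simp only [mul_sub, mul_ite, mul_one, mul_zero, Finset.sum_sub_distrib, Finset.sum_ite_eq',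
        mem_support_iff]
      rw [← hf.coeff_eq, ← hf.coeff_eq]
      congr 1 <;> simp +contextual [eq_comm]
    · simp

/-! ### Top coefficients of the Demazure atoms -/

/-- The exponent of `x₁ ⋯ x_l`. -/
def step (l : Fin n) : Fin n → ℕ := fun p => if p ≤ l then 1 else 0

/-- The exponent of the monomial `x_I`. -/
def xExp (I : Finset (Fin (n - 1))) : Fin n → ℕ := ∑ i ∈ I, step (lo i)

theorem psum_step (l : Fin n) (k : ℕ) : psum (step l) k = min k (l + 1) := by
  have : Finset.filter (fun x : Fin n => x ≤ l)
      (Finset.univ.filter fun p : Fin n => (p : ℕ) < k) =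
      Finset.univ.filter fun p : Fin n => (p : ℕ) < min k (l + 1) := by
    ext p
    simp only [Finset.mem_filter, Finset.mem_univ, true_and, Fin.le_def, lt_min_iff,
      Nat.lt_succ_iff]
  simp only [psum, step]
  rw [ Finset.sum_ite, Finset.sum_const_zero, add_zero, Finset.sum_const, this,
    card_filter_lt]
  have := l.2
  simp only [smul_eq_mul, mul_one]
  omega

theorem sum_single_apply (A : Finset (Fin n)) (p : Fin n) :
    (∑ j ∈ A, Finsupp.single j 1 : Fin n →₀ ℕ) p = if p ∈ A then 1 else 0 := by
  simp [Finsupp.finsetSum_apply, Finsupp.single_apply]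

theorem dominated_sum_single {A : Finset (Fin n)} {l : Fin n} (hA : A.card ≤ l + 1) :
    Dominated (∑ j ∈ A, Finsupp.single j 1) (step l) := fun S => by
  rw [psum_step, Finset.sum_congr rfl fun p _ => sum_single_apply A p, Finset.sum_boole,
    Nat.cast_id]
  refine le_min (Finset.card_filter_le _ _) (le_trans (Finset.card_le_card ?_) hA)
  intro p hp
  exact (Finset.mem_filter.1 hp).2

theorem prod_X_eq_monomial (A : Finset (Fin n)) :
    (∏ j ∈ A, X j : MvPolynomial (Fin n) F) = monomial (∑ j ∈ A, Finsupp.single j 1) 1 := by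
  rw [monomial_sum_one]; rfl

theorem xMonomial_eq (I : Finset (Fin (n - 1))) :
    xMonomial F I = monomial (permExp 1 (xExp I)) 1 := by
  have : permExp 1 (xExp I) = ∑ i ∈ I, ∑ j ∈ Finset.Iic (lo i), Finsupp.single j 1 := by
    ext p
    rw [Finsupp.finsetSum_apply, Finset.sum_congr rfl fun i _ => sum_single_apply _ p]
    simp [xExp, step]
  rw [this, monomial_sum_one, xMonomial]
  exact Finset.prod_congr rfl fun i _ => prod_X_eq_monomial _

theorem dominated_xExp (I : Finset (Fin (n - 1))) : Dominated (permExp 1 (xExp I)) (xExp I) := by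
  classical
  induction I using Finset.induction_on with
  | empty => intro S; simp [xExp]
  | insert i I hi ih =>
    rw [xExp, Finset.sum_insert hi, permExp_add]
    refine Dominated.add ?_ ih
    have : permExp 1 (step (lo i)) = ∑ j ∈ Finset.Iic (lo i), Finsupp.single j 1 := by
      ext p
      rw [sum_single_apply]
      simp [step]
    rw [this]
    exact dominated_sum_single (by simp)

open Classical in
theorem hasTop_xMonomial (I : Finset (Fin (n - 1))) :
    HasTop (xMonomial F I) (xExp I)
      fun u => if permExp u (xExp I) = permExp 1 (xExp I) then 1 else 0 where
  dominated a ha := by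
    rw [xMonomial_eq, coeff_monomial, ite_ne_right_iff] at ha
    rw [← ha.1]; exact dominated_xExp I
  coeff_eq u := by
    rw [xMonomial_eq, coeff_monomial]
    exact if_congr eq_comm rfl rfl

theorem xExp_antitone (I : Finset (Fin (n - 1))) : Antitone (xExp I) := by
  intro p q hpq
  simp only [xExp, Finset.sum_apply]
  refine Finset.sum_le_sum fun i _ => ?_
  simp only [step]
  split_ifs with h₁ h₂
  exacts [le_rfl, absurd (hpq.trans h₁) h₂, Nat.zero_le _, le_rfl]

/-- If `x_I` has equal exponents at two positions and `I` contains the descents of `w`, then `w`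
increases between these positions. -/
theorem lt_of_xExp_eq {w : Equiv.Perm (Fin n)} {I : Finset (Fin (n - 1))} (hI : descents w ⊆ I)
    {p q : Fin n} (hpq : p < q) (h : xExp I p = xExp I q) : w p < w q := by
  refine lt_of_forall_lo_lt_hi w hpq fun i hi₁ hi₂ => ?_
  by_contra hlt
  have hiI : i ∈ I := hI (mem_descents.2
    (lt_of_le_of_ne (not_lt.1 hlt) fun h => lo_ne_hi i (w.injective h).symm))
  refine h.not_gt ?_
  simp only [xExp, Finset.sum_apply]
  refine Finset.sum_lt_sum (fun j _ => ?_) ⟨i, hiI, ?_⟩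
  · simp only [step]
    split_ifs with h₁ h₂
    exacts [le_rfl, absurd (hpq.le.trans h₁) h₂, Nat.zero_le _, le_rfl]
  · simp [step, hi₁, hi₂]

open Classical in
/-- The top part of `π̄_w x_I` is the single monomial `w(x_I)` when `D(w) ⊆ I`: every letter of a
reduced word of `w` moves a strictly larger exponent to the right. -/
theorem hasTop_demazureBarPerm {w : Equiv.Perm (Fin n)} {I : Finset (Fin (n - 1))}
    (hI : descents w ⊆ I) :
    HasTop (demazureBarPerm F w (xMonomial F I)) (xExp I)
      fun u => if permExp u (xExp I) = permExp w (xExp I) then 1 else 0 := by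
  suffices h : ∀ l₁ l₂, l₁ ++ l₂ = reducedWord w →
      HasTop ((l₂.map (demazureBar F)).prod (xMonomial F I)) (xExp I)
        fun u => if permExp u (xExp I) = permExp (wordProd l₂) (xExp I) then 1 else 0 by
    have := h [] (reducedWord w) rfl
    rwa [wordProd_reducedWord] at this
  intro l₁ l₂
  induction l₂ generalizing l₁ with
  | nil => intro _; exact hasTop_xMonomial I
  | cons i l₂ ih =>
    intro h
    have ih' := (ih (l₁ ++ [i]) (by simpa using h)).demazureBar i
    have hlet := (h ▸ reducedWord_spec w : IsReducedWord (l₁ ++ i :: l₂) w).letter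
    have hlt : xExp I ((wordProd l₂)⁻¹ (hi i)) < xExp I ((wordProd l₂)⁻¹ (lo i)) := by
      refine lt_of_le_of_ne (xExp_antitone I hlet.1.le) fun heq => ?_
      exact (lt_of_xExp_eq hI hlet.1 heq.symm).not_gt hlet.2
    rw [List.map_cons, List.prod_cons, Module.End.mul_apply, wordProd_cons]
    convert ih' using 1
    funext u
    simp only [permExp_adjSwap_mul_eq_iff]
    by_cases h₁ : permExp u (xExp I) = permExp (adjSwap i * wordProd l₂) (xExp I)
    · have e₁ := DFunLike.congr_fun h₁ (lo i)
      have e₂ := DFunLike.congr_fun h₁ (hi i)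
      simp only [permExp_apply, mul_inv_rev, adjSwap_inv, Equiv.Perm.mul_apply, adjSwap_lo,
        adjSwap_hi] at e₁ e₂
      rw [if_pos h₁, if_pos (by rw [e₁, e₂]; exact hlt), if_neg, sub_zero]
      intro h₂
      have := DFunLike.congr_fun h₂ (lo i)
      simp only [permExp_apply] at this
      rw [this] at e₁
      exact hlt.ne' e₁
    · by_cases h₂ : permExp u (xExp I) = permExp (wordProd l₂) (xExp I)
      · have e₁ := DFunLike.congr_fun h₂ (lo i)
        have e₂ := DFunLike.congr_fun h₂ (hi i)
        simp only [permExp_apply] at e₁ e₂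
        rw [if_neg h₁, if_neg]
        rw [e₁, e₂]; exact hlt.not_gt
      · simp [h₁, h₂]

/-- The top coefficients of the elementary symmetric polynomials are all `1`. -/
theorem hasTop_esymmOn (l : Fin n) : HasTop (esymmOn F Finset.univ (l + 1)) (step l) 1 where
  dominated a ha := by
    rw [esymmOn, coeff_sum] at ha
    obtain ⟨A, hA, h⟩ := Finset.exists_ne_zero_of_sum_ne_zero ha
    classical
    rw [prod_X_eq_monomial, coeff_monomial, ite_ne_right_iff] at h
    rw [← h.1]
    exact dominated_sum_single (Finset.mem_powersetCard.1 hA).2.le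
  coeff_eq u := by
    classical
    have key : ∀ A : Finset (Fin n), (∑ j ∈ A, Finsupp.single j 1 : Fin n →₀ ℕ) =
        permExp u (step l) ↔ A = (Finset.Iic l).map u.toEmbedding := by
      intro A
      rw [Finsupp.ext_iff, Finset.ext_iff]
      refine forall_congr' fun a => ?_
      rw [sum_single_apply, permExp_apply, step, Finset.mem_map_equiv, Finset.mem_Iic]
      change _ ↔ (a ∈ A ↔ u⁻¹ a ≤ l)
      split_ifs <;> simp_all
    rw [esymmOn, coeff_sum, Finset.sum_congr rfl fun A _ => by
      rw [prod_X_eq_monomial, coeff_monomial, if_congr (key A) rfl rfl],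
      Finset.sum_ite_eq', if_pos]
    · rfl
    · simp

end Top

/-! ### Unitriangular families of polynomials -/

section Triangular

variable {F : Type*} [Field F] {σ ι α : Type*} [LinearOrder α] {v : ι → MvPolynomial σ F}
  {e : ι → σ →₀ ℕ} {key : ι → α}

theorem linearIndependent_of_triangular (hone : ∀ i, coeff (e i) (v i) = 1)
    (htri : ∀ i j, coeff (e j) (v i) ≠ 0 → j = i ∨ key j < key i) : LinearIndependent F v := by
  classical
  rw [linearIndependent_iff']
  intro s g hg
  by_contra! hne
  obtain ⟨i₀, hi₀, hgi₀⟩ := hne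
  obtain ⟨i, hi, hmax⟩ := Finset.exists_max_image (s.filter fun i => g i ≠ 0) key
    ⟨i₀, Finset.mem_filter.2 ⟨hi₀, hgi₀⟩⟩
  rw [Finset.mem_filter] at hi
  have h := congrArg (coeff (e i)) hg
  rw [coeff_sum, Finset.sum_eq_single i, coeff_smul, hone, coeff_zero, smul_eq_mul, mul_one] at h
  · exact hi.2 h
  · intro j hj hji
    rw [coeff_smul, smul_eq_mul]
    by_contra hne
    rcases htri j i (right_ne_zero_of_mul hne) with h' | h'
    · exact hji h'.symm
    · exact (hmax j (Finset.mem_filter.2 ⟨hj, left_ne_zero_of_mul hne⟩)).not_gt h'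
  · exact fun h' => absurd hi.1 h'

/-- If the members of the family whose leading exponents lie in `K` only involve exponents in `K`,
they span all monomials with exponents in `K`. -/
theorem monomial_mem_span_of_triangular [WellFoundedLT α] (hone : ∀ i, coeff (e i) (v i) = 1)
    (htri : ∀ i j, coeff (e j) (v i) ≠ 0 → j = i ∨ key j < key i) (he : Function.Surjective e)
    (K : Set (σ →₀ ℕ)) (hK : ∀ i, e i ∈ K → ∀ b, coeff b (v i) ≠ 0 → b ∈ K) {b : σ →₀ ℕ}
    (hb : b ∈ K) : monomial b (1 : F) ∈ Submodule.span F (v '' {i | e i ∈ K}) := by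
  classical
  obtain ⟨i, rfl⟩ := he b
  induction hk : key i using WellFoundedLT.induction generalizing i with
  | _ k ih =>
  subst hk
  have hv : v i ∈ Submodule.span F (v '' {i | e i ∈ K}) := Submodule.subset_span ⟨i, hb, rfl⟩
  have hrest : v i - monomial (e i) 1 ∈ Submodule.span F (v '' {i | e i ∈ K}) := by
    rw [(v i - monomial (e i) (1 : F)).as_sum]
    refine Submodule.sum_mem _ fun b' hb' => ?_
    rw [mem_support_iff, coeff_sub, coeff_monomial] at hb'
    have hne : e i ≠ b' := by
      rintro rfl
      rw [hone, if_pos rfl, sub_self] at hb'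
      exact hb' rfl
    rw [if_neg hne, sub_zero] at hb'
    obtain ⟨j, rfl⟩ := he b'
    have hlt : key j < key i := (htri i j hb').resolve_left fun h => hne (h ▸ rfl)
    rw [← mul_one (coeff _ _), ← smul_eq_mul, ← smul_monomial]
    exact Submodule.smul_mem _ _ (ih _ hlt j (hK i hb _ hb') rfl)
  simpa using Submodule.sub_mem _ hv hrest

end Triangular

/-! ### A basis of the polynomial ring -/

section PolyBasis

variable {n : ℕ}

/-- The partition of the leading exponent of `e₁^{c₁} ⋯ eₙ^{cₙ} π̄_w x_I`. -/
def expOf (c : Fin n → ℕ) (I : Finset (Fin (n - 1))) : Fin n → ℕ := (∑ j, c j • step j) + xExp I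

theorem expOf_apply (c : Fin n → ℕ) (I : Finset (Fin (n - 1))) (p : Fin n) :
    expOf c I p = (∑ j, if p ≤ j then c j else 0) + ∑ i ∈ I, if p ≤ lo i then 1 else 0 := by
  simp [expOf, xExp, step]

theorem expOf_lo (c : Fin n → ℕ) (I : Finset (Fin (n - 1))) (i : Fin (n - 1)) :
    expOf c I (lo i) = expOf c I (hi i) + c (lo i) + if i ∈ I then 1 else 0 := by
  have h : ∀ j : Fin n, (lo i ≤ j ↔ hi i ≤ j ∨ j = lo i) ∧ ¬(hi i ≤ j ∧ j = lo i) := by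
    intro j
    simp only [lo, hi, Fin.le_def, Fin.ext_iff]
    omega
  have h₁ : ∀ j, (if lo i ≤ j then c j else 0) =
      (if hi i ≤ j then c j else 0) + if j = lo i then c j else 0 := by
    intro j
    have := h j
    split_ifs <;> omega
  have h₂ : ∀ k : Fin (n - 1), (if lo i ≤ lo k then 1 else 0) =
      (if hi i ≤ lo k then 1 else 0) + if i = k then 1 else 0 := by
    intro k
    have h' := h (lo k)
    have : lo k = lo i ↔ i = k := by simp [lo, Fin.ext_iff, eq_comm]
    rw [this] at h'
    split_ifs <;> omega
  rw [expOf_apply, expOf_apply, Finset.sum_congr rfl fun j _ => h₁ j,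
    Finset.sum_congr rfl fun k _ => h₂ k, Finset.sum_add_distrib, Finset.sum_add_distrib]
  simp only [Finset.sum_ite_eq', Finset.sum_ite_eq, Finset.mem_univ, if_true]
  ring

theorem expOf_last (c : Fin n → ℕ) (I : Finset (Fin (n - 1))) {p : Fin n} (hp : (p : ℕ) + 1 = n) :
    expOf c I p = c p := by
  rw [expOf_apply, Finset.sum_eq_single p, if_pos le_rfl, Finset.sum_eq_zero, add_zero]
  · intro i _
    rw [if_neg]
    have := i.2
    simp only [lo, Fin.le_def]
    omega
  · intro j _ hj
    rw [if_neg]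
    intro h
    have := j.2
    exact hj (Fin.ext (by rw [Fin.le_def] at h; omega))
  · simp

theorem eq_of_lo_hi {f g : Fin n → ℕ} (hlast : ∀ p : Fin n, (p : ℕ) + 1 = n → f p = g p)
    (hstep : ∀ i : Fin (n - 1), f (hi i) = g (hi i) → f (lo i) = g (lo i)) : f = g := by
  have : ∀ k : ℕ, ∀ p : Fin n, (p : ℕ) + k + 1 = n → f p = g p := by
    intro k
    induction k with
    | zero => exact fun p hp => hlast p hp
    | succ k ih =>
      intro p hp
      exact hstep ⟨p, by omega⟩ (ih _ (by simp [hi]; omega))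
  funext p
  exact this (n - 1 - p) p (by omega)

theorem expOf_injective (I : Finset (Fin (n - 1))) :
    Function.Injective fun c : Fin n → ℕ => expOf c I := by
  intro c c' h
  funext p
  by_cases hp : (p : ℕ) + 1 = n
  · rw [← expOf_last c I hp, ← expOf_last c' I hp]
    exact congrFun h p
  · obtain ⟨i, rfl⟩ : ∃ i : Fin (n - 1), p = lo i := ⟨⟨p, by omega⟩, rfl⟩
    have h₁ := expOf_lo c I i
    have h₂ := expOf_lo c' I i
    have h₃ : expOf c I (lo i) = expOf c' I (lo i) := congrFun h _
    have h₄ : expOf c I (hi i) = expOf c' I (hi i) := congrFun h _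
    omega

theorem exists_eq_expOf {lam : Fin n → ℕ} {I : Finset (Fin (n - 1))}
    (hle : ∀ i, lam (hi i) ≤ lam (lo i)) (hlt : ∀ i ∈ I, lam (hi i) < lam (lo i)) :
    ∃ c, lam = expOf c I := by
  refine ⟨fun p => if h : (p : ℕ) + 1 = n then lam p else
    lam p - lam (hi ⟨p, by omega⟩) - if (⟨p, by omega⟩ : Fin (n - 1)) ∈ I then 1 else 0,
    eq_of_lo_hi (fun p hp => by rw [expOf_last _ _ hp, dif_pos hp]) fun i h => ?_⟩
  have h₁ : ((lo i : Fin n) : ℕ) + 1 ≠ n := by simp only [lo]; omega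
  rw [expOf_lo, ← h, dif_neg h₁]
  change lam (lo i) = lam (hi i) + (lam (lo i) - lam (hi i) - if i ∈ I then 1 else 0) +
    if i ∈ I then 1 else 0
  have := hle i
  split_ifs with hI
  · have := hlt i hI
    omega
  · omega

/-- The exponent `w(lam)`, for the partition `lam` of the index `(c, w)`. -/
def leadExp (x : (Fin n → ℕ) × Equiv.Perm (Fin n)) : Fin n →₀ ℕ :=
  permExp x.2 (expOf x.1 (descents x.2))

/-- Every exponent `a` is the leading exponent of an index: `w` is the stable permutation sorting
`a` decreasingly, and its descents are strict descents of the sorted exponent. -/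
theorem leadExp_surjective : Function.Surjective (leadExp (n := n)) := by
  intro a
  have hw := (Tuple.eq_sort_iff (f := OrderDual.toDual ∘ a)
    (σ := Tuple.sort (OrderDual.toDual ∘ a))).1 rfl
  set w := Tuple.sort (OrderDual.toDual ∘ a)
  have hle : ∀ i, a (w (hi i)) ≤ a (w (lo i)) := fun i => hw.1 (lo_lt_hi i).le
  obtain ⟨c, hc⟩ := exists_eq_expOf (lam := a ∘ w) (I := descents w) hle fun i hiw =>
    lt_of_le_of_ne (hle i) fun h =>
      (mem_descents.1 hiw).not_gt (hw.2 _ _ (lo_lt_hi i) (congrArg OrderDual.toDual h.symm))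
  refine ⟨(c, w), ?_⟩
  ext p
  simp [leadExp, ← hc]

/-- The order on indices for which the family `basisElt` is unitriangular: first the dominance
order of the partitions (linearized), then the reverse lexicographic order of the permutations. -/
def key (x : (Fin n → ℕ) × Equiv.Perm (Fin n)) : ℕ ×ₗ (Lex (Fin n → Fin n))ᵒᵈ :=
  toLex (∑ k ∈ Finset.range (n + 1), psum (expOf x.1 (descents x.2)) k,
    OrderDual.toDual (toLex ⇑x.2))

variable (F : Type*) [Field F]

/-- The product `e₁^{c₁} ⋯ eₙ^{cₙ} π̄_w x_{D(w)}`. -/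
def basisElt (x : (Fin n → ℕ) × Equiv.Perm (Fin n)) : MvPolynomial (Fin n) F :=
  (∏ j : Fin n, esymmOn F Finset.univ (j + 1) ^ x.1 j) * atom F x.2

open Classical in
theorem hasTop_basisElt (x : (Fin n → ℕ) × Equiv.Perm (Fin n)) :
    HasTop (basisElt F x) (expOf x.1 (descents x.2)) fun u =>
      if permExp u (xExp (descents x.2)) = permExp x.2 (xExp (descents x.2)) then 1 else 0 := by
  have := (HasTop.prod Finset.univ fun j _ => (hasTop_esymmOn (F := F) j).pow (x.1 j)).mul
    (hasTop_demazureBarPerm (F := F) (subset_refl (descents x.2)))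
  rwa [one_mul] at this

theorem coeff_leadExp_basisElt (x : (Fin n → ℕ) × Equiv.Perm (Fin n)) :
    coeff (leadExp x) (basisElt F x) = 1 := by
  classical
  rw [leadExp, (hasTop_basisElt F x).coeff_eq, if_pos rfl]

theorem eq_or_key_lt_of_coeff_ne_zero (x y : (Fin n → ℕ) × Equiv.Perm (Fin n))
    (h : coeff (leadExp y) (basisElt F x) ≠ 0) : y = x ∨ key y < key x := by
  classical
  obtain ⟨c, w⟩ := x
  obtain ⟨c', w'⟩ := y
  have htop := hasTop_basisElt F (c, w)
  have hle : ∀ k ≤ n, psum (expOf c' (descents w')) k ≤ psum (expOf c (descents w)) k := by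
    intro k hk
    have := (htop.dominated _ h).psum_le w' hk
    rwa [leadExp, permExp_comp] at this
  by_cases hlt : ∃ k ≤ n, psum (expOf c' (descents w')) k < psum (expOf c (descents w)) k
  · right
    obtain ⟨k, hk, hkl⟩ := hlt
    rw [key, key, Prod.Lex.toLex_lt_toLex]
    left
    exact Finset.sum_lt_sum (fun j hj => hle j (by rw [Finset.mem_range] at hj; omega))
      ⟨k, Finset.mem_range.2 (by omega), hkl⟩
  push Not at hlt
  have heq : expOf c' (descents w') = expOf c (descents w) :=
    eq_of_psum_eq fun k hk => le_antisymm (hle k hk) (hlt k hk)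
  rw [leadExp, heq, htop.coeff_eq, ite_ne_right_iff] at h
  have hx : ∀ q, xExp (descents w) (w'⁻¹ q) = xExp (descents w) (w⁻¹ q) := fun q =>
    DFunLike.congr_fun h.1 q
  by_cases hw : w' = w
  · subst hw
    left
    rw [expOf_injective _ heq]
  right
  have hw' : ∃ p, w' p ≠ w p := by
    by_contra! hc
    exact hw (Equiv.ext hc)
  -- At the first place `p` of difference, `w' p = w q` for some `q > p` with equal exponents.
  obtain ⟨p, hp, hmin⟩ := WellFounded.has_min (wellFounded_lt (α := Fin n)) {p | w' p ≠ w p} hw'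
  have hbefore : ∀ q < p, w' q = w q := fun q hq => by
    by_contra hne
    exact hmin q hne hq
  rw [key, key, Prod.Lex.toLex_lt_toLex]
  refine Or.inr ⟨by rw [heq], ?_⟩
  rw [OrderDual.toDual_lt_toDual]
  refine ⟨p, fun j hj => (hbefore j hj).symm, ?_⟩
  change w p < w' p
  have hq : xExp (descents w) p = xExp (descents w) (w⁻¹ (w' p)) := by simpa using hx (w' p)
  have hwq : w (w⁻¹ (w' p)) = w' p := by simp
  have hpq : p < w⁻¹ (w' p) := by
    rcases lt_trichotomy p (w⁻¹ (w' p)) with h' | h' | h'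
    · exact h'
    · rw [← h'] at hwq
      exact absurd hwq.symm hp
    · exact absurd (w'.injective ((hbefore _ h').trans hwq)) h'.ne
  exact (lt_of_xExp_eq subset_rfl hpq hq).trans_eq hwq

theorem linearIndependent_basisElt : LinearIndependent F (basisElt F (n := n)) :=
  linearIndependent_of_triangular (coeff_leadExp_basisElt F) (eq_or_key_lt_of_coeff_ne_zero F)

/-- Monomials with exponents in `K` are spanned by the `basisElt`s with leading exponent in `K`,
provided these only involve exponents in `K`. -/
theorem monomial_mem_span_basisElt (K : Set (Fin n →₀ ℕ))
    (hK : ∀ x, leadExp x ∈ K → ∀ b, coeff b (basisElt F x) ≠ 0 → b ∈ K) {b : Fin n →₀ ℕ}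
    (hb : b ∈ K) : monomial b (1 : F) ∈ Submodule.span F (basisElt F '' {x | leadExp x ∈ K}) :=
  monomial_mem_span_of_triangular (coeff_leadExp_basisElt F) (eq_or_key_lt_of_coeff_ne_zero F)
    leadExp_surjective K hK hb

theorem span_basisElt : Submodule.span F (Set.range (basisElt F (n := n))) = ⊤ := by
  rw [eq_top_iff]
  intro f _
  rw [f.as_sum]
  refine Submodule.sum_mem _ fun b _ => ?_
  rw [← mul_one (coeff _ _), ← smul_eq_mul, ← smul_monomial]
  refine Submodule.smul_mem _ _ (Submodule.span_mono (Set.image_subset_range _ _)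
    (monomial_mem_span_basisElt F Set.univ (fun _ _ _ _ => Set.mem_univ _) (Set.mem_univ b)))

end PolyBasis

/-! ### Monomials with large support -/

section Wide

variable {n : ℕ} (F : Type*) [Field F]

/-- The ideal of polynomials all of whose monomials involve at least `h` variables. -/
def wideIdeal (n h : ℕ) : Ideal (MvPolynomial (Fin n) F) where
  carrier := {f | ∀ b, coeff b f ≠ 0 → h ≤ b.support.card}
  add_mem' {f g} hf hg b hb := by
    rw [coeff_add] at hb
    by_cases h' : coeff b f = 0
    · exact hg b fun h'' => hb (by rw [h', h'', add_zero])
    · exact hf b h'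
  zero_mem' b hb := absurd (coeff_zero b) hb
  smul_mem' g f hf b hb := by
    classical
    rw [smul_eq_mul, coeff_mul] at hb
    obtain ⟨⟨b₁, b₂⟩, hb₁₂, hne⟩ := Finset.exists_ne_zero_of_sum_ne_zero hb
    rw [← Finset.HasAntidiagonal.mem_antidiagonal.1 hb₁₂]
    exact (hf b₂ (right_ne_zero_of_mul hne)).trans
      (Finset.card_le_card (Finsupp.support_mono le_add_self))

variable {F} {h : ℕ}

theorem monomial_mem_wideIdeal {b : Fin n →₀ ℕ} (hb : h ≤ b.support.card) (r : F) :
    monomial b r ∈ wideIdeal F n h := by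
  classical
  intro b' hb'
  rw [coeff_monomial, ite_ne_right_iff] at hb'
  rwa [← hb'.1]

theorem demazureBar_mem_wideIdeal {f : MvPolynomial (Fin n) F} (hf : f ∈ wideIdeal F n h)
    (i : Fin (n - 1)) : demazureBar F i f ∈ wideIdeal F n h := by
  intro b hb
  obtain ⟨c, p, j, hc, hj, rfl, hcoeff⟩ := exists_of_coeff_demazureBar_ne_zero F hb
  have hc' : h ≤ (insert (hi i) c.support).card := by
    by_cases h₀ : c (hi i) = 0
    · have h₁ : hi i ∉ c.support := by simpa using h₀
      have h₂ : lo i ∉ c.support := by simpa [hc] using h₀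
      rw [Finset.card_insert_of_notMem h₁]
      rcases hcoeff with hcoeff | hcoeff
      · refine (hf _ hcoeff).trans ?_
        rw [← Finset.card_insert_of_notMem h₂]
        refine Finset.card_le_card fun a ha => ?_
        by_cases hal : a = lo i
        · exact hal ▸ Finset.mem_insert_self _ _
        · refine Finset.mem_insert_of_mem ?_
          simpa [Ne.symm hal] using ha
      · refine (hf _ hcoeff).trans ?_
        rw [← Finset.card_insert_of_notMem h₁]
        refine Finset.card_le_card fun a ha => ?_
        by_cases hal : a = hi i
        · exact hal ▸ Finset.mem_insert_self _ _
        · refine Finset.mem_insert_of_mem ?_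
          simpa [Ne.symm hal] using ha
    · rcases hcoeff with hcoeff | hcoeff
      all_goals
        refine (hf _ hcoeff).trans (Finset.card_le_card fun a ha => Finset.mem_insert_of_mem ?_)
        by_cases hal : a = lo i
        · subst hal; simpa [hc] using h₀
        by_cases hah : a = hi i
        · subst hah; simpa using h₀
        simpa [Ne.symm hal, Ne.symm hah] using ha
  refine hc'.trans (Finset.card_le_card fun a ha => ?_)
  rw [Finset.mem_insert] at ha
  rw [Finsupp.mem_support_iff, Finsupp.add_apply, Finsupp.add_apply]
  rcases ha with rfl | ha
  · simp only [Finsupp.single_eq_same]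
    omega
  · rw [Finsupp.mem_support_iff] at ha
    omega

theorem demazureBarPerm_mem_wideIdeal {f : MvPolynomial (Fin n) F} (hf : f ∈ wideIdeal F n h)
    (w : Equiv.Perm (Fin n)) : demazureBarPerm F w f ∈ wideIdeal F n h := by
  rw [demazureBarPerm]
  induction reducedWord w with
  | nil => simpa using hf
  | cons i l ih =>
    rw [List.map_cons, List.prod_cons, Module.End.mul_apply]
    exact demazureBar_mem_wideIdeal ih i

theorem support_sum_single (A : Finset (Fin n)) :
    (∑ j ∈ A, Finsupp.single j 1 : Fin n →₀ ℕ).support = A := by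
  ext p
  rw [Finsupp.mem_support_iff, sum_single_apply]
  simp

theorem prod_X_mem_wideIdeal {A : Finset (Fin n)} (hA : h ≤ A.card) :
    (∏ j ∈ A, X j : MvPolynomial (Fin n) F) ∈ wideIdeal F n h := by
  rw [prod_X_eq_monomial]
  exact monomial_mem_wideIdeal (by rwa [support_sum_single]) 1

theorem esymmOn_mem_wideIdeal (S : Finset (Fin n)) {r : ℕ} (hr : h ≤ r) :
    esymmOn F S r ∈ wideIdeal F n h :=
  Ideal.sum_mem _ fun _ hA => prod_X_mem_wideIdeal (by rwa [(Finset.mem_powersetCard.1 hA).2])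

theorem xMonomial_mem_wideIdeal {I : Finset (Fin (n - 1))} {i : Fin (n - 1)} (hi : i ∈ I)
    (hh : h ≤ i + 1) : xMonomial F I ∈ wideIdeal F n h :=
  Ideal.mem_of_dvd _ (Finset.dvd_prod_of_mem _ hi) (prod_X_mem_wideIdeal (by simpa [lo] using hh))

/-- If a leading exponent involves at least `h` variables, then so do all exponents of the
corresponding basis element. -/
theorem basisElt_mem_wideIdeal (hpos : 1 ≤ h) {x : (Fin n → ℕ) × Equiv.Perm (Fin n)}
    (hx : h ≤ (leadExp x).support.card) :
    basisElt F x ∈ wideIdeal F n h ∧ (x.1 ≠ 0 ∨ ∃ i ∈ descents x.2, h ≤ i + 1) := by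
  have key : (∃ j : Fin n, h ≤ j + 1 ∧ x.1 j ≠ 0) ∨ ∃ i ∈ descents x.2, h ≤ (i : ℕ) + 1 := by
    by_contra! hcon
    have hsupp : (leadExp x).support ⊆
        (Finset.univ.filter fun p : Fin n => (p : ℕ) < h - 1).map x.2.toEmbedding := by
      intro a ha
      rw [Finset.mem_map_equiv, Finset.mem_filter]
      refine ⟨Finset.mem_univ _, ?_⟩
      change ((x.2⁻¹ a : Fin n) : ℕ) < h - 1
      by_contra hlt
      rw [Finsupp.mem_support_iff, leadExp, permExp_apply, expOf_apply] at ha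
      refine ha ?_
      rw [Finset.sum_eq_zero (s := Finset.univ) fun j _ => ?_, zero_add,
        Finset.sum_eq_zero fun i hiD => ?_]
      · have := hcon.2 i hiD
        rw [if_neg]
        simp only [lo, Fin.le_def]
        omega
      · split_ifs with hj
        · rw [Fin.le_def] at hj
          exact hcon.1 j (by omega)
        · rfl
    have := hx.trans (Finset.card_le_card hsupp)
    rw [Finset.card_map, card_filter_lt] at this
    omega
  rcases key with ⟨j, hj, hcj⟩ | ⟨i, hiD, hih⟩
  · refine ⟨Ideal.mul_mem_right _ _ (Ideal.mem_of_dvd _ (Finset.dvd_prod_of_mem _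
      (Finset.mem_univ j)) (Ideal.pow_mem_of_mem _ (esymmOn_mem_wideIdeal _ hj) _
      (Nat.pos_of_ne_zero hcj))), Or.inl fun h₀ => hcj (by rw [h₀]; rfl)⟩
  · exact ⟨Ideal.mul_mem_left _ _ (demazureBarPerm_mem_wideIdeal
      (xMonomial_mem_wideIdeal hiD hih) _), Or.inr ⟨i, hiD, hih⟩⟩

end Wide

/-! ### The Tanisaki ideal of a hook -/

section Hook

variable {n : ℕ} {μ : n.Partition}

/-- `μ` is the hook with `h` parts. -/
structure HookWith (μ : n.Partition) (h : ℕ) : Prop where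
  pos : 1 ≤ h
  le : h ≤ n
  parts : μ.parts = (n - h + 1) ::ₘ Multiset.replicate (h - 1) 1

variable {h : ℕ}

theorem HookWith.conjPart_eq (hμ : HookWith μ h) (j : ℕ) :
    conjPart μ j = (if h ≤ j then 1 else 0) + if n ≤ j then h - 1 else 0 := by
  have h₁ := hμ.pos
  have h₂ := hμ.le
  have e₁ : n + 1 - j ≤ n - h + 1 ↔ h ≤ j := by omega
  have e₂ : n + 1 - j ≤ 1 ↔ n ≤ j := by omega
  rw [conjPart, hμ.parts, Multiset.filter_cons, Multiset.card_add]
  congr 1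
  · rw [if_congr e₁ rfl rfl]
    split_ifs <;> simp
  · split_ifs with hn
    · rw [Multiset.filter_eq_self.2, Multiset.card_replicate]
      intro a ha
      rw [Multiset.eq_of_mem_replicate ha]
      exact e₂.2 hn
    · rw [Multiset.filter_eq_nil.2, Multiset.card_zero]
      intro a ha
      rw [Multiset.eq_of_mem_replicate ha, e₂]
      exact hn

theorem HookWith.dSum_of_lt (hμ : HookWith μ h) {k : ℕ} (hk : k < n) : dSum μ k = k + 1 - h := by
  have : (Finset.Icc 1 k).filter (fun j => h ≤ j) = Finset.Icc h k := by
    ext j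
    have := hμ.pos
    simp only [Finset.mem_filter, Finset.mem_Icc]
    omega
  rw [dSum, ← Nat.card_Icc h k, ← this, Finset.card_filter]
  refine Finset.sum_congr rfl fun j hj => ?_
  rw [Finset.mem_Icc] at hj
  rw [hμ.conjPart_eq, if_neg (by omega : ¬n ≤ j), add_zero]

theorem HookWith.dSum_self (hμ : HookWith μ h) : dSum μ n = n := by
  have h₁ := hμ.pos
  have h₂ := hμ.le
  obtain ⟨m, rfl⟩ : ∃ m, n = m + 1 := ⟨n - 1, by omega⟩
  have := hμ.dSum_of_lt (Nat.lt_succ_self m)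
  rw [dSum, Finset.sum_Icc_succ_top (by omega), hμ.conjPart_eq, if_pos h₂, if_pos le_rfl]
  rw [dSum] at this
  omega

/-- The composition of the hook with `h` parts is `(1, …, 1, n - h + 1)`. -/
theorem HookWith.mem_compDescents (hμ : HookWith μ h) (i : Fin (n - 1)) :
    i ∈ compDescents (toComposition μ) ↔ (i : ℕ) + 1 < h := by
  have h₁ := hμ.pos
  have hb : (toComposition μ).blocks = List.replicate (h - 1) 1 ++ [n - h + 1] := by
    have hs : (List.replicate (h - 1) 1 ++ [n - h + 1]).Pairwise (· ≤ ·) := by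
      rw [List.pairwise_append]
      refine ⟨by simp [List.pairwise_replicate], by simp, ?_⟩
      intro a ha b hb
      rw [List.eq_of_mem_replicate ha, List.mem_singleton.1 hb]
      omega
    change μ.parts.sort (· ≤ ·) = _
    refine List.Perm.eq_of_pairwise' (Multiset.pairwise_sort _ _) hs ?_
    rw [← Multiset.coe_eq_coe, Multiset.sort_eq, hμ.parts, ← Multiset.coe_add,
      Multiset.coe_replicate,
      Multiset.coe_singleton, ← Multiset.singleton_add, add_comm]
  have hlen : (toComposition μ).length = h := by
    rw [Composition.length, hb, List.length_append, List.length_replicate, List.length_singleton]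
    omega
  have hsize : ∀ k < h, (toComposition μ).sizeUpTo k = k := by
    intro k hk
    rw [Composition.sizeUpTo, hb, List.take_append_of_le_length (by simp; omega),
      List.take_replicate, List.sum_replicate]
    simp
    omega
  rw [compDescents, Finset.mem_filter, hlen, Finset.mem_image]
  simp only [Finset.mem_univ, true_and, Finset.mem_Ioo]
  constructor
  · rintro ⟨k, hk, hki⟩
    rw [hsize k hk.2] at hki
    omega
  · exact fun hi => ⟨i + 1, ⟨by omega, hi⟩, hsize _ hi⟩

variable (F : Type*) [Field F]

theorem esymmOn_card (S : Finset (Fin n)) : esymmOn F S S.card = ∏ j ∈ S, X j := by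
  rw [esymmOn, Finset.powersetCard_self, Finset.sum_singleton]

/-- The Tanisaki ideal of a hook with `h` parts is generated by the symmetric polynomials without
constant term and the squarefree monomials of degree `h`. -/
theorem HookWith.tanisaki_eq (hμ : HookWith μ h) :
    tanisaki F μ = Ideal.span (Set.range fun l : Fin n => esymmOn F Finset.univ (l + 1)) ⊔
      wideIdeal F n h := by
  have h₁ := hμ.pos
  have h₂ := hμ.le
  apply le_antisymm
  · refine Ideal.span_le.2 ?_
    rintro f ⟨S, r, hS, hr, hlt, rfl⟩
    have hSn : S.card ≤ n := by simpa using Finset.card_le_univ S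
    rcases hSn.eq_or_lt with hSn | hSn
    · rw [hSn, hμ.dSum_self] at hlt
      have hr' : r - 1 + 1 = r := by omega
      obtain rfl : S = Finset.univ := Finset.eq_univ_of_card S (by simpa using hSn)
      exact Ideal.mem_sup_left (Ideal.subset_span ⟨⟨r - 1, by omega⟩, by simp only [hr']⟩)
    · rw [hμ.dSum_of_lt hSn] at hlt
      exact Ideal.mem_sup_right (esymmOn_mem_wideIdeal S (by omega))
  · refine sup_le (Ideal.span_le.2 ?_) fun f hf => ?_
    · rintro f ⟨l, rfl⟩
      refine Ideal.subset_span ⟨Finset.univ, l + 1, ?_, ?_, ?_, rfl⟩ <;>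
        simp only [Finset.card_univ, Fintype.card_fin, hμ.dSum_self] <;> omega
    · rw [f.as_sum]
      refine Ideal.sum_mem _ fun b hb => ?_
      obtain ⟨S, hSb, hS⟩ := Finset.exists_subset_card_eq (hf b (mem_support_iff.1 hb))
      have hmem : (∏ j ∈ S, X j : MvPolynomial (Fin n) F) ∈ tanisaki F μ := by
        refine Ideal.subset_span ⟨S, S.card, by omega, le_rfl, ?_, (esymmOn_card F S).symm⟩
        have : 1 ≤ dSum μ S.card := by
          rw [hS]
          rcases h₂.eq_or_lt with rfl | hlt
          · rw [hμ.dSum_self]; exact h₁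
          · rw [hμ.dSum_of_lt hlt]; omega
        omega
      refine Ideal.mem_of_dvd _ ?_ hmem
      rw [prod_X_eq_monomial, monomial_dvd_monomial]
      refine ⟨Or.inr fun a => ?_, one_dvd _⟩
      rw [sum_single_apply]
      split_ifs with ha
      · exact Nat.one_le_iff_ne_zero.2 (Finsupp.mem_support_iff.1 (hSb ha))
      · exact Nat.zero_le _

theorem rename_esymmOn_univ (u : Equiv.Perm (Fin n)) (r : ℕ) :
    rename u (esymmOn F Finset.univ r) = esymmOn F Finset.univ r := by
  simp only [esymmOn, map_sum, map_prod, rename_X]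
  refine Finset.sum_equiv (Equiv.finsetCongr u) (fun A => ?_) fun A _ => ?_
  · simp [Finset.mem_powersetCard]
  · simp

theorem HookWith.demazureBar_mem_tanisaki (hμ : HookWith μ h) {f : MvPolynomial (Fin n) F}
    (hf : f ∈ tanisaki F μ) (i : Fin (n - 1)) : demazureBar F i f ∈ tanisaki F μ := by
  rw [hμ.tanisaki_eq F] at hf ⊢
  obtain ⟨a, ha, b, hb, rfl⟩ := Submodule.mem_sup.1 hf
  rw [map_add]
  refine Ideal.add_mem _ (Ideal.mem_sup_left ?_)
    (Ideal.mem_sup_right (demazureBar_mem_wideIdeal hb i))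
  obtain ⟨c, rfl⟩ := Ideal.mem_span_range_iff_exists_fun.1 ha
  rw [map_sum]
  refine Ideal.sum_mem _ fun l _ => ?_
  rw [mul_comm, demazureBar_mul F (rename_esymmOn_univ F _ _)]
  exact Ideal.mul_mem_right _ _ (Ideal.subset_span ⟨l, rfl⟩)

/-! ### The basis of Demazure atoms -/

/-- The indices of the basis elements of `F[x]` that span the Tanisaki ideal of the hook with
descent set `J`. -/
def tanisakiIndices (J : Finset (Fin (n - 1))) : Set ((Fin n → ℕ) × Equiv.Perm (Fin n)) :=
  {x | x.1 ≠ 0 ∨ ¬descents x.2 ⊆ J}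

theorem basisElt_mul_esymmOn (x : (Fin n → ℕ) × Equiv.Perm (Fin n)) (l : Fin n) :
    basisElt F x * esymmOn F Finset.univ (l + 1) = basisElt F (x.1 + Pi.single l 1, x.2) := by
  rw [basisElt, basisElt, mul_right_comm]
  congr 1
  simp only [Pi.add_apply, pow_add, Finset.prod_mul_distrib]
  congr 1
  rw [Finset.prod_eq_single l]
  · simp
  · intro j _ hj
    simp [hj]
  · simp

/-- The Tanisaki ideal is spanned by members of the basis of `F[x]`: multiplication by `e_l` shifts
the exponent `c`, and the monomials in at least `h` variables are handled by unitriangularity. -/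
theorem HookWith.mem_tanisaki_iff (hμ : HookWith μ h) (f : MvPolynomial (Fin n) F) :
    f ∈ tanisaki F μ ↔ f ∈ Submodule.span F
      (basisElt F '' tanisakiIndices (compDescents (toComposition μ))) := by
  have h₁ := hμ.pos
  constructor
  · intro hf
    rw [hμ.tanisaki_eq F] at hf
    obtain ⟨a, ha, b, hb, rfl⟩ := Submodule.mem_sup.1 hf
    refine Submodule.add_mem _ ?_ ?_
    · obtain ⟨c, rfl⟩ := Ideal.mem_span_range_iff_exists_fun.1 ha
      refine Submodule.sum_mem _ fun l _ => ?_
      have hc : c l ∈ Submodule.span F (Set.range (basisElt F (n := n))) := by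
        rw [span_basisElt]; trivial
      generalize c l = g at hc ⊢
      induction hc using Submodule.span_induction with
      | mem _ hx =>
        obtain ⟨x, rfl⟩ := hx
        rw [basisElt_mul_esymmOn]
        refine Submodule.subset_span ⟨_, Or.inl fun h₀ => ?_, rfl⟩
        have := congrFun h₀ l
        simp at this
      | zero => simp
      | add x y _ _ hx hy => rw [add_mul]; exact Submodule.add_mem _ hx hy
      | smul r x _ hx => rw [smul_mul_assoc]; exact Submodule.smul_mem _ _ hx
    · rw [b.as_sum]
      refine Submodule.sum_mem _ fun e he => ?_
      rw [← mul_one (coeff _ _), ← smul_eq_mul, ← smul_monomial]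
      refine Submodule.smul_mem _ _ (Submodule.span_mono (Set.image_mono ?_)
        (monomial_mem_span_basisElt F {e | h ≤ e.support.card}
          (fun x hx => (basisElt_mem_wideIdeal h₁ hx).1) (hb e (mem_support_iff.1 he))))
      intro x hx
      refine (basisElt_mem_wideIdeal (F := F) h₁ hx).2.imp id ?_
      rintro ⟨i, hiD, hih⟩ hsub
      have := (hμ.mem_compDescents i).1 (hsub hiD)
      omega
  · intro hf
    have hle : Submodule.span F
        (basisElt F '' tanisakiIndices (compDescents (toComposition μ))) ≤
        (tanisaki F μ).restrictScalars F := by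
      refine Submodule.span_le.2 ?_
      rintro _ ⟨x, hx, rfl⟩
      rw [SetLike.mem_coe, Submodule.restrictScalars_mem, hμ.tanisaki_eq F]
      rcases hx with hx | hx
      · obtain ⟨j, hj⟩ := Function.ne_iff.1 hx
        exact Ideal.mem_sup_left (Ideal.mul_mem_right _ _ (Ideal.mem_of_dvd _
          (Finset.dvd_prod_of_mem _ (Finset.mem_univ j)) (Ideal.pow_mem_of_mem _
            (Ideal.subset_span (Set.mem_range_self j)) _ (Nat.pos_of_ne_zero hj))))
      · obtain ⟨i, hiD, hi⟩ := Finset.not_subset.1 hx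
        rw [hμ.mem_compDescents] at hi
        exact Ideal.mem_sup_right (Ideal.mul_mem_left _ _ (demazureBarPerm_mem_wideIdeal
          (xMonomial_mem_wideIdeal hiD (by omega)) _))
    exact hle hf

/-- The image in `R_μ` of the Demazure atom of `w`. -/
def atomImage (μ : n.Partition)
    (w : {w : Equiv.Perm (Fin n) // descents w ⊆ compDescents (toComposition μ)}) :
    springerRing F μ :=
  Ideal.Quotient.mk (tanisaki F μ) (atom F w.1)

theorem basisElt_zero (w : Equiv.Perm (Fin n)) : basisElt F (0, w) = atom F w := by
  simp [basisElt]

theorem HookWith.linearIndependent_atomImage (hμ : HookWith μ h) :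
    LinearIndependent F (atomImage F μ) := by
  have he : atomImage F μ = (Ideal.Quotient.mkₐ F (tanisaki F μ)).toLinearMap ∘ basisElt F ∘
      fun w : {w : Equiv.Perm (Fin n) // descents w ⊆ compDescents (toComposition μ)} =>
        ((0 : Fin n → ℕ), w.1) :=
    funext fun w => by simp [atomImage, basisElt_zero]
  rw [he]
  have hli := (linearIndependent_basisElt F (n := n)).comp
    (fun w : {w : Equiv.Perm (Fin n) // descents w ⊆ compDescents (toComposition μ)} =>
      ((0 : Fin n → ℕ), w.1))
    fun w w' hww' => Subtype.ext (congrArg Prod.snd hww')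
  refine hli.map (f := (Ideal.Quotient.mkₐ F (tanisaki F μ)).toLinearMap) ?_
  have hdisj := (linearIndependent_basisElt F (n := n)).disjoint_span_image
    (disjoint_compl_left (a := tanisakiIndices (compDescents (toComposition μ))))
  refine hdisj.mono (Submodule.span_mono ?_) fun f hf => ?_
  · rintro _ ⟨w, rfl⟩
    exact ⟨(0, w.1), fun h => h.elim (fun h => h rfl) fun h => h w.2, rfl⟩
  · refine (hμ.mem_tanisaki_iff F f).1 (Ideal.Quotient.eq_zero_iff_mem.1 ?_)
    exact LinearMap.mem_ker.1 hf

theorem HookWith.span_atomImage (hμ : HookWith μ h) :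
    ⊤ ≤ Submodule.span F (Set.range (atomImage F μ)) := by
  intro y _
  obtain ⟨f, rfl⟩ := Ideal.Quotient.mk_surjective y
  have hf : f ∈ Submodule.span F (Set.range (basisElt F (n := n))) := by
    rw [span_basisElt]; trivial
  induction hf using Submodule.span_induction with
  | mem _ hx =>
    obtain ⟨x, rfl⟩ := hx
    by_cases hx : x ∈ tanisakiIndices (compDescents (toComposition μ))
    · rw [Ideal.Quotient.eq_zero_iff_mem.2
        ((hμ.mem_tanisaki_iff F _).2 (Submodule.subset_span ⟨x, hx, rfl⟩))]
      exact Submodule.zero_mem _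
    · obtain ⟨c, w⟩ := x
      simp only [tanisakiIndices, Set.mem_ofPred_eq, not_or, not_not] at hx
      obtain ⟨rfl, hw⟩ := hx
      rw [basisElt_zero]
      exact Submodule.subset_span ⟨⟨w, hw⟩, rfl⟩
  | zero => rw [map_zero]; exact Submodule.zero_mem _
  | add x y _ _ hx hy => rw [map_add]; exact Submodule.add_mem _ (hx trivial) (hy trivial)
  | smul r x _ hx => exact Submodule.smul_mem _ r (hx trivial)

/-- The basis of `R_μ` consisting of the images of the Demazure atoms. -/
def HookWith.atomBasis (hμ : HookWith μ h) : Module.Basis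
    {w : Equiv.Perm (Fin n) // descents w ⊆ compDescents (toComposition μ)} F
    (springerRing F μ) :=
  Module.Basis.mk (hμ.linearIndependent_atomImage F) (hμ.span_atomImage F)

end Hook

/-! ### The 0-Hecke algebra -/

section HeckeAlgebra

variable (F : Type*) [Field F] {n : ℕ}

theorem T_mul_self (i : Fin (n - 1)) : T F i * T F i = -T F i := by
  rw [T, ← map_mul, ← map_neg]
  exact RingQuot.mkAlgHom_rel F (HeckeRel.quad i)

theorem braidFamily_T : BraidFamily (T F (n := n)) where
  comm i j h := by
    simp only [T, ← map_mul]
    exact RingQuot.mkAlgHom_rel F (HeckeRel.comm i j h)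
  braid i j h := by
    simp only [T, ← map_mul]
    exact RingQuot.mkAlgHom_rel F (HeckeRel.braid i j h)

theorem braidFamily_T' : BraidFamily (T' F (n := n)) where
  comm i j h := by
    have hc := (braidFamily_T F).comm i j h
    simp only [T', add_mul, mul_add, hc, one_mul, mul_one]
    abel
  braid i j h := by
    have key : ∀ a b : Hecke F n, a * a = -a →
        (a + 1) * (b + 1) * (a + 1) = a * b * a + a * b + b * a + a + b + 1 := by
      intro a b ha
      simp only [add_mul, mul_add, one_mul, mul_one, ha]
      abel
    rw [T', T', key _ _ (T_mul_self F i), key _ _ (T_mul_self F j), (braidFamily_T F).braid i j h]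
    abel

theorem T_mul_Tperm_of_lt {i : Fin (n - 1)} {w : Equiv.Perm (Fin n)}
    (h : w⁻¹ (lo i) < w⁻¹ (hi i)) : T F i * Tperm F w = Tperm F (adjSwap i * w) :=
  ((braidFamily_T F).prod_reducedWord_cons h).symm

theorem T_mul_Tperm_of_gt {i : Fin (n - 1)} {w : Equiv.Perm (Fin n)}
    (h : w⁻¹ (hi i) < w⁻¹ (lo i)) : T F i * Tperm F w = -Tperm F w := by
  have := T_mul_Tperm_of_lt F ((inv_adjSwap_mul_lt_iff w i).2 h)
  rw [adjSwap_mul_cancel] at this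
  rw [← this, ← mul_assoc, T_mul_self, neg_mul (T F i) _]

theorem Tperm_mul_T_of_notMem {i : Fin (n - 1)} {w : Equiv.Perm (Fin n)} (h : i ∉ descents w) :
    Tperm F w * T F i = Tperm F (w * adjSwap i) ∧ len (w * adjSwap i) = len w + 1 := by
  have hlt : w (lo i) < w (hi i) := lt_of_le_of_ne
    (not_lt.1 fun hlt => h (mem_descents.2 hlt)) fun h => lo_ne_hi i (w.injective h)
  exact ⟨((braidFamily_T F).prod_reducedWord_concat hlt).symm, len_mul_adjSwap_of_lt hlt⟩

theorem Tperm_mul_T_of_mem {i : Fin (n - 1)} {w : Equiv.Perm (Fin n)} (h : i ∈ descents w) :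
    Tperm F w * T F i = -Tperm F w := by
  have := (braidFamily_T F).prod_reducedWord_concat (w := w * adjSwap i) (i := i)
    (by simpa using mem_descents.1 h)
  rw [mul_adjSwap_cancel] at this
  rw [Tperm, this, mul_assoc, T_mul_self, mul_neg _ (T F i)]

theorem Tperm_one : Tperm F (1 : Equiv.Perm (Fin n)) = 1 := by
  have h : reducedWord (1 : Equiv.Perm (Fin n)) = [] :=
    List.eq_nil_of_length_eq_zero
      (Nat.le_zero.1 ((reducedWord_spec (1 : Equiv.Perm (Fin n))).2 [] wordProd_nil))
  rw [Tperm, h]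
  rfl

/-- A subspace stable under left multiplication by the generators is a left ideal. -/
theorem mul_mem_of_T_mul_mem {S : Submodule F (Hecke F n)}
    (hS : ∀ i, ∀ y ∈ S, T F i * y ∈ S) (x : Hecke F n) {y : Hecke F n} (hy : y ∈ S) :
    x * y ∈ S := by
  obtain ⟨a, rfl⟩ := RingQuot.mkAlgHom_surjective F (HeckeRel F n) x
  induction a using FreeAlgebra.induction generalizing y with
  | grade0 r => rw [AlgHom.commutes, ← Algebra.smul_def]; exact S.smul_mem r hy
  | grade1 i => exact hS i y hy
  | mul a b ha hb => rw [map_mul, mul_assoc]; exact ha (hb hy)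
  | add a b ha hb => rw [map_add, add_mul]; exact S.add_mem (ha hy) (hb hy)

theorem descents_subset_adjSwap_mul {i : Fin (n - 1)} {w : Equiv.Perm (Fin n)}
    (h : w⁻¹ (lo i) < w⁻¹ (hi i)) : descents w ⊆ descents (adjSwap i * w) := by
  intro j hj
  have : (lo j, hi j) ∈ inversions (adjSwap i * w) := by
    rw [inversions_adjSwap_mul h]
    exact Finset.mem_insert_of_mem (mem_inversions.2 ⟨lo_lt_hi j, mem_descents.1 hj⟩)
  exact mem_descents.2 (mem_inversions.1 this).2

/-- The `T_w` with `I ⊆ D(w)` span a left ideal. -/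
theorem mul_mem_span_Tperm {I : Finset (Fin (n - 1))} (x : Hecke F n) {y : Hecke F n}
    (hy : y ∈ Submodule.span F (Tperm F '' {w | I ⊆ descents w})) :
    x * y ∈ Submodule.span F (Tperm F '' {w | I ⊆ descents w}) := by
  refine mul_mem_of_T_mul_mem F (fun i y hy => ?_) x hy
  induction hy using Submodule.span_induction with
  | mem _ hy =>
    obtain ⟨w, hw, rfl⟩ := hy
    rcases inv_lo_lt_or_gt w i with h | h
    · rw [T_mul_Tperm_of_lt F h]
      exact Submodule.subset_span ⟨_, Finset.Subset.trans hw (descents_subset_adjSwap_mul h), rfl⟩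
    · rw [T_mul_Tperm_of_gt F h]
      exact Submodule.neg_mem _ (Submodule.subset_span ⟨w, hw, rfl⟩)
  | zero => rw [mul_zero]; exact Submodule.zero_mem _
  | add y z _ _ hy hz => rw [mul_add]; exact Submodule.add_mem _ hy hz
  | smul r y _ hy => rw [mul_smul_comm]; exact Submodule.smul_mem _ r hy

theorem span_Tperm : ⊤ ≤ Submodule.span F (Set.range (Tperm F (n := n))) := by
  intro x _
  have h1 : (1 : Hecke F n) ∈ Submodule.span F (Tperm F '' {w | ∅ ⊆ descents w}) :=
    Submodule.subset_span ⟨1, Finset.empty_subset _, Tperm_one F⟩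
  have := mul_mem_span_Tperm F x h1
  rw [mul_one] at this
  exact Submodule.span_mono (Set.image_subset_range _ _) this

/-! ### Representations of the 0-Hecke algebra -/

variable {F}

/-- The algebra morphism out of `H_n(0)` defined by a family satisfying its relations. -/
def heckeLift {A : Type*} [Ring A] [Algebra F A] (t : Fin (n - 1) → A)
    (hquad : ∀ i, t i * t i = -t i) (ht : BraidFamily t) : Hecke F n →ₐ[F] A :=
  RingQuot.liftAlgHom F ⟨FreeAlgebra.lift F t, by
    rintro _ _ (i | ⟨i, j, h⟩ | ⟨i, j, h⟩)
    · simpa using hquad i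
    · simpa using ht.comm i j h
    · simpa using ht.braid i j h⟩

theorem heckeLift_T {A : Type*} [Ring A] [Algebra F A] (t : Fin (n - 1) → A)
    (hquad : ∀ i, t i * t i = -t i) (ht : BraidFamily t) (i : Fin (n - 1)) :
    heckeLift (F := F) t hquad ht (T F i) = t i := by
  rw [heckeLift, T, RingQuot.liftAlgHom_mkAlgHom_apply, FreeAlgebra.lift_ι_apply]

variable (F)

/-- The action of `H_n(0)` on `F[x]` by the operators `π̄_i`. -/
def polyRep (n : ℕ) : Hecke F n →ₐ[F] Module.End F (MvPolynomial (Fin n) F) :=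
  heckeLift (demazureBar F) (demazureBar_mul_self F) (braidFamily_demazureBar F)

theorem polyRep_Tperm (w : Equiv.Perm (Fin n)) : polyRep F n (Tperm F w) = demazureBarPerm F w := by
  rw [Tperm, map_list_prod, List.map_map, demazureBarPerm]
  congr 2
  funext i
  exact heckeLift_T _ _ _ i

/-- The `T_w` are linearly independent: the polynomials `π̄_w x_{{1, …, n - 1}}` have distinct
leading monomials `x₁^{n - 1} x₂^{n - 2} ⋯ x_{n-1}`, permuted by `w`. -/
theorem linearIndependent_Tperm : LinearIndependent F (Tperm F (n := n)) := by
  classical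
  have hinj : Function.Injective (xExp (Finset.univ : Finset (Fin (n - 1)))) := by
    have hlt : ∀ p q : Fin n, p < q → xExp Finset.univ p ≠ xExp Finset.univ q := by
      intro p q hpq h
      have := lt_of_xExp_eq (w := Equiv.swap p q) (Finset.subset_univ _) hpq h
      rw [Equiv.swap_apply_left, Equiv.swap_apply_right] at this
      exact this.not_gt hpq
    intro p q h
    rcases lt_trichotomy p q with h' | h' | h'
    exacts [absurd h (hlt p q h'), h', absurd h.symm (hlt q p h')]
  let φ : Hecke F n →ₗ[F] Equiv.Perm (Fin n) → F := LinearMap.pi fun u =>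
    lcoeff F (permExp u (xExp Finset.univ)) ∘ₗ
      LinearMap.applyₗ (xMonomial F Finset.univ) ∘ₗ (polyRep F n).toLinearMap
  refine LinearIndependent.of_comp φ ?_
  have : φ ∘ Tperm F = fun w => Pi.single w 1 := by
    funext w u
    have h := (hasTop_demazureBarPerm (F := F) (Finset.subset_univ (descents w))).coeff_eq u
    change coeff (permExp u (xExp Finset.univ))
      (polyRep F n (Tperm F w) (xMonomial F Finset.univ)) = _
    rw [polyRep_Tperm, h, Pi.single_apply]
    refine if_congr ⟨fun h => ?_, fun h => by rw [h]⟩ rfl rfl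
    refine inv_injective (Equiv.ext fun a => hinj ?_)
    exact DFunLike.congr_fun h a
  rw [this]
  exact Pi.linearIndependent_single_one _ _

theorem finrank_hecke : Module.finrank F (Hecke F n) = Fintype.card (Equiv.Perm (Fin n)) :=
  Module.finrank_eq_card_basis
    (Module.Basis.mk (linearIndependent_Tperm F) (span_Tperm F (n := n)))

/-! ### The projective indecomposable modules -/

/-- The element `T_w T'_{w₀(D(w)ᶜ)}`. For fixed descent set `D(w) = D(α)`, these elements
span `P_α`; all together, they form a basis of `H_n(0)`. -/
def heckeElt (w : Equiv.Perm (Fin n)) : Hecke F n :=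
  Tperm F w * Tperm' F (longest (descents w)ᶜ)

theorem Tperm_mul_Tperm' {w : Equiv.Perm (Fin n)} {J : Finset (Fin (n - 1))} {i : Fin (n - 1)}
    (hw : i ∈ descents w) (hJ : i ∈ J) : Tperm F w * Tperm' F (longest J) = 0 := by
  have := (braidFamily_T' F).prod_reducedWord_cons (w := adjSwap i * longest J) (i := i)
    (by simpa using longest_left_descent hJ)
  rw [adjSwap_mul_cancel] at this
  rw [Tperm', this, ← mul_assoc, T', mul_add, Tperm_mul_T_of_mem F hw, mul_one, neg_add_cancel,
    zero_mul]

/-- Right multiplication by `T_{w₀(I)}` is a sign on `T_w` when `I ⊆ D(w)`. -/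
theorem Tperm_mul_Tperm_longest {w : Equiv.Perm (Fin n)} {I : Finset (Fin (n - 1))}
    (hI : I ⊆ descents w) :
    Tperm F w * Tperm F (longest I) = (-1 : F) ^ len (longest I) • Tperm F w := by
  have h : ∀ l : List (Fin (n - 1)), (∀ i ∈ l, i ∈ I) →
      Tperm F w * (l.map (T F)).prod = (-1 : F) ^ l.length • Tperm F w := by
    intro l
    induction l with
    | nil => simp
    | cons i l ih =>
      intro hl
      rw [List.forall_mem_cons] at hl
      rw [List.map_cons, List.prod_cons, ← mul_assoc, Tperm_mul_T_of_mem F (hI hl.1),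
        neg_mul (Tperm F w) _, ih hl.2, List.length_cons, pow_succ', mul_smul, neg_one_smul F _]
  exact h _ mem_of_mem_reducedWord_longest

/-- As `T_w` is, up to sign, `T_w T_{w₀(I)}` for `I = D(w)`, it lies in the left ideal
of `T_{w₀(I)}`. -/
theorem heckeElt_mem_projIndec {w : Equiv.Perm (Fin n)} {α : Composition n}
    (h : descents w = compDescents α) : heckeElt F w ∈ projIndec F α := by
  have h₁ := Tperm_mul_Tperm_longest F (subset_refl (descents w))
  have h₂ : heckeElt F w = ((-1 : F) ^ len (longest (descents w)) • Tperm F w) *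
      (Tperm F (longest (descents w)) * Tperm' F (longest (descents w)ᶜ)) := by
    rw [← mul_assoc, smul_mul_assoc, h₁, smul_smul, ← pow_add, Even.neg_one_pow ⟨_, rfl⟩,
      one_smul, heckeElt]
  rw [h₂, h]
  exact Submodule.smul_mem _ _ (Submodule.mem_span_singleton_self _)

/-- A left multiple of `T_{w₀(I)}` is a combination of `T_w` with `I ⊆ D(w)`, and `T'_{w₀(Iᶜ)}`
annihilates those with `I ≠ D(w)`. -/
theorem projIndec_le_span {α : Composition n} {x : Hecke F n} (hx : x ∈ projIndec F α) :
    x ∈ Submodule.span F (heckeElt F '' {w | descents w = compDescents α}) := by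
  obtain ⟨y, rfl⟩ := Submodule.mem_span_singleton.1 hx
  have hy := mul_mem_span_Tperm F y (Submodule.subset_span
    ⟨longest (compDescents α), subset_descents_longest _, rfl⟩)
  rw [smul_eq_mul, ← mul_assoc]
  generalize y * Tperm F (longest (compDescents α)) = z at hy ⊢
  induction hy using Submodule.span_induction with
  | mem _ hy =>
    obtain ⟨w, hw, rfl⟩ := hy
    by_cases hw' : descents w = compDescents α
    · have : Tperm F w * Tperm' F (longest (compDescents α)ᶜ) = heckeElt F w := by
        rw [← hw', heckeElt]
      rw [this]
      exact Submodule.subset_span ⟨w, hw', rfl⟩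
    · obtain ⟨i, hiw, hiα⟩ := Finset.exists_of_ssubset
        (Finset.ssubset_iff_subset_ne.2 ⟨hw, Ne.symm hw'⟩)
      rw [Tperm_mul_Tperm' F hiw (Finset.mem_compl.2 hiα)]
      exact Submodule.zero_mem _
  | zero => rw [zero_mul]; exact Submodule.zero_mem _
  | add y z _ _ hy hz => rw [add_mul]; exact Submodule.add_mem _ hy hz
  | smul r y _ hy => rw [smul_mul_assoc]; exact Submodule.smul_mem _ r hy

/-- The span of the `T_u` with `u` of length at least `k`. -/
def longSpan (n k : ℕ) : Submodule F (Hecke F n) := Submodule.span F (Tperm F '' {u | k ≤ len u})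

variable {F}

theorem mul_T_mem_longSpan {k : ℕ} {y : Hecke F n} (hy : y ∈ longSpan F n k) (i : Fin (n - 1)) :
    y * T F i ∈ longSpan F n k := by
  induction hy using Submodule.span_induction with
  | mem _ hy =>
    obtain ⟨w, hw, rfl⟩ := hy
    by_cases h : i ∈ descents w
    · rw [Tperm_mul_T_of_mem F h]
      exact Submodule.neg_mem _ (Submodule.subset_span ⟨w, hw, rfl⟩)
    · obtain ⟨h₁, h₂⟩ := Tperm_mul_T_of_notMem F h
      rw [h₁]
      refine Submodule.subset_span ⟨_, ?_, rfl⟩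
      change k ≤ len _
      rw [h₂]
      exact Nat.le_succ_of_le hw
  | zero => rw [zero_mul]; exact Submodule.zero_mem _
  | add y z _ _ hy hz => rw [add_mul]; exact Submodule.add_mem _ hy hz
  | smul r y _ hy => rw [smul_mul_assoc]; exact Submodule.smul_mem _ r hy

theorem mul_prod_T'_mem_longSpan {k : ℕ} {y : Hecke F n} (hy : y ∈ longSpan F n k)
    (l : List (Fin (n - 1))) : y * (l.map (T' F)).prod ∈ longSpan F n k := by
  induction l generalizing y with
  | nil => simpa using hy
  | cons i l ih =>
    rw [List.map_cons, List.prod_cons, ← mul_assoc]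
    refine ih ?_
    rw [T', mul_add, mul_one]
    exact Submodule.add_mem _ (mul_T_mem_longSpan hy i) hy

variable (F)

/-- `T_w T'_{w₀(D(w)ᶜ)}` is `T_w` plus a combination of `T_u` with `u` longer: the letters of
`w₀(D(w)ᶜ)` are not descents of `w`. -/
theorem heckeElt_sub_mem_longSpan (w : Equiv.Perm (Fin n)) :
    heckeElt F w - Tperm F w ∈ longSpan F n (len w + 1) := by
  have h : ∀ l : List (Fin (n - 1)), (∀ i ∈ l, i ∈ (descents w)ᶜ) →
      Tperm F w * (l.map (T' F)).prod - Tperm F w ∈ longSpan F n (len w + 1) := by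
    intro l
    induction l with
    | nil => intro _; simp
    | cons i l ih =>
      intro hl
      rw [List.forall_mem_cons, Finset.mem_compl] at hl
      obtain ⟨h₁, h₂⟩ := Tperm_mul_T_of_notMem F hl.1
      rw [List.map_cons, List.prod_cons, ← mul_assoc, T', mul_add, mul_one, h₁, add_mul,
        add_sub_assoc]
      exact Submodule.add_mem _ (mul_prod_T'_mem_longSpan
        (Submodule.subset_span ⟨_, h₂.ge, rfl⟩) l) (ih hl.2)
  exact h _ mem_of_mem_reducedWord_longest

theorem span_heckeElt : ⊤ ≤ Submodule.span F (Set.range (heckeElt F (n := n))) := by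
  refine (span_Tperm F).trans (Submodule.span_le.2 ?_)
  rintro _ ⟨w, rfl⟩
  have hbound : ∀ u : Equiv.Perm (Fin n), len u ≤ n * n := fun u => by
    rw [len_eq_card_inversions]
    exact (Finset.card_le_univ _).trans (by simp)
  induction hk : n * n - len w using Nat.strong_induction_on generalizing w with
  | _ k ih =>
  have h₁ : heckeElt F w ∈ Submodule.span F (Set.range (heckeElt F)) :=
    Submodule.subset_span ⟨w, rfl⟩
  have h₂ : longSpan F n (len w + 1) ≤ Submodule.span F (Set.range (heckeElt F)) := by
    refine Submodule.span_le.2 ?_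
    rintro _ ⟨u, hu, rfl⟩
    have hu' : len w + 1 ≤ len u := hu
    have := hbound u
    exact ih (n * n - len u) (by omega) u rfl
  simpa using Submodule.sub_mem _ h₁ (h₂ (heckeElt_sub_mem_longSpan F w))

theorem linearIndependent_heckeElt : LinearIndependent F (heckeElt F (n := n)) :=
  linearIndependent_of_top_le_span_of_card_eq_finrank (span_heckeElt F) (finrank_hecke F).symm

/-! ### Direct sums of projective indecomposable modules -/

/-- Compositions of `n` correspond to their descent sets. -/
theorem compDescents_bijective : Function.Bijective (compDescents (n := n)) := by
  have : compDescents = compositionAsSetEquiv n ∘ compositionEquiv n := by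
    funext α
    ext i
    have hi := i.2
    simp only [compDescents, compositionEquiv, compositionAsSetEquiv, Composition.boundaries,
      Composition.boundary, Composition.toCompositionAsSet, Finset.mem_filter, Finset.mem_univ,
      true_and, Finset.mem_image, Finset.mem_Ioo, Function.comp_apply, Equiv.coe_fn_mk,
      Set.mem_toFinset, Set.mem_ofPred_eq, Finset.mem_map, RelEmbedding.coe_toEmbedding,
      OrderEmbedding.coe_ofStrictMono, Fin.mk.injEq]
    constructor
    · rintro ⟨j, hj, hji⟩
      exact ⟨⟨j, by omega⟩, by simp only; omega⟩
    · rintro ⟨j, hji⟩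
      refine ⟨j, ⟨Nat.pos_of_ne_zero fun h₀ => ?_, ?_⟩, by omega⟩
      · rw [h₀, Composition.sizeUpTo_zero] at hji
        omega
      · by_contra hlt
        rw [show (j : ℕ) = α.length by omega, Composition.sizeUpTo_length] at hji
        omega
  rw [this]
  exact (compositionAsSetEquiv n).bijective.comp (compositionEquiv n).bijective

variable {F}

/-- The composition with descent set `D(w)`. -/
def descentComp (w : Equiv.Perm (Fin n)) : Composition n :=
  (compDescents_bijective.2 (descents w)).choose

theorem compDescents_descentComp (w : Equiv.Perm (Fin n)) :
    compDescents (descentComp w) = descents w :=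
  (compDescents_bijective.2 (descents w)).choose_spec

variable {J : Finset (Fin (n - 1))}

open Classical in
/-- The element of `⨁ P_α`, over the `α` with `D(α) ⊆ J`, given by `T_w T'_{w₀(D(w)ᶜ)}`. -/
def sumElt (F : Type*) [Field F] (J : Finset (Fin (n - 1)))
    (w : {w : Equiv.Perm (Fin n) // descents w ⊆ J}) :
    DirectSum {α : Composition n // compDescents α ⊆ J} fun α => projIndec F α.1 :=
  DirectSum.lof (Hecke F n) _ (fun α : {α : Composition n // compDescents α ⊆ J} =>
    projIndec F α.1)
    ⟨descentComp w.1, by rw [compDescents_descentComp]; exact w.2⟩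
    ⟨heckeElt F w.1, heckeElt_mem_projIndec F (compDescents_descentComp w.1).symm⟩

theorem span_sumElt : Submodule.span F (Set.range (sumElt F J)) = ⊤ := by
  classical
  rw [eq_top_iff]
  intro x _
  induction x using DirectSum.induction_on with
  | zero => exact Submodule.zero_mem _
  | add x y hx hy => exact Submodule.add_mem _ (hx trivial) (hy trivial)
  | of α x =>
    obtain ⟨α, hα⟩ := α
    let f := (DirectSum.lof (Hecke F n) _ (fun α : {α : Composition n // compDescents α ⊆ J} =>
      projIndec F α.1) ⟨α, hα⟩).restrictScalars F
    let s := (projIndec F α).subtype.restrictScalars F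
    have hle : Submodule.span F (heckeElt F '' {w | descents w = compDescents α}) ≤
        ((Submodule.span F (Set.range (sumElt F J))).comap f).map s := by
      refine Submodule.span_le.2 ?_
      rintro _ ⟨w, hw, rfl⟩
      obtain rfl : descentComp w = α :=
        compDescents_bijective.1 ((compDescents_descentComp w).trans hw)
      exact ⟨⟨heckeElt F w, heckeElt_mem_projIndec F hw⟩,
        Submodule.subset_span ⟨⟨w, hw.trans_subset hα⟩, rfl⟩, rfl⟩
    obtain ⟨x', hx', hxx'⟩ := hle (projIndec_le_span F x.2)
    obtain rfl : x' = x := Subtype.ext hxx'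
    exact hx'

/-- A morphism from `⨁ P_α` sending the elements `T_w T'_{w₀(D(w)ᶜ)}` to a basis is bijective. -/
theorem bijective_of_sumElt {M : Type*} [AddCommGroup M] [Module F M] [Module (Hecke F n) M]
    [IsScalarTower F (Hecke F n) M]
    (φ : (DirectSum {α : Composition n // compDescents α ⊆ J} fun α => projIndec F α.1)
      →ₗ[Hecke F n] M)
    (hli : LinearIndependent F (φ ∘ sumElt F J))
    (hspan : ⊤ ≤ Submodule.span F (Set.range (φ ∘ sumElt F J))) : Function.Bijective φ := by
  set ψ := φ.restrictScalars F
  have hψ : φ ∘ sumElt F J = ψ ∘ sumElt F J := rfl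
  rw [hψ] at hli hspan
  change Function.Bijective ψ
  constructor
  · intro x y hxy
    have hmem : ∀ x, ∃ c, Finsupp.linearCombination F (sumElt F J) c = x := fun x => by
      rw [← LinearMap.mem_range, Finsupp.range_linearCombination, span_sumElt]
      trivial
    obtain ⟨c, rfl⟩ := hmem x
    obtain ⟨d, rfl⟩ := hmem y
    rw [LinearMap.map_finsupp_linearCombination, LinearMap.map_finsupp_linearCombination] at hxy
    rw [hli hxy]
  · rw [Set.range_comp, ← Submodule.map_span, span_sumElt, Submodule.map_top] at hspan
    exact LinearMap.range_eq_top.1 (top_le_iff.1 hspan)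

open Classical in
/-- The morphism `⨁ P_α → M` sending `p` in `P_α` to `p • x_α`. -/
def sumToModule (J : Finset (Fin (n - 1))) {M : Type*} [AddCommGroup M] [Module (Hecke F n) M]
    (x : Composition n → M) :
    (DirectSum {α : Composition n // compDescents α ⊆ J} fun α => projIndec F α.1)
      →ₗ[Hecke F n] M :=
  DirectSum.toModule (Hecke F n) _ M fun α =>
    LinearMap.toSpanSingleton (Hecke F n) M (x α.1) ∘ₗ (projIndec F α.1).subtype

theorem sumToModule_sumElt {M : Type*} [AddCommGroup M] [Module (Hecke F n) M]
    (x : Composition n → M) (w : {w : Equiv.Perm (Fin n) // descents w ⊆ J}) :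
    sumToModule J x (sumElt F J w) = heckeElt F w.1 • x (descentComp w.1) := by
  classical
  exact DirectSum.toModule_lof ..

/-- `H_n(0)` is the direct sum of the left ideals `P_α`, over all compositions `α`. -/
theorem bijective_sumToModule_one :
    Function.Bijective (sumToModule (F := F) (Finset.univ : Finset (Fin (n - 1)))
      fun _ => (1 : Hecke F n)) := by
  have hφ : sumToModule (F := F) Finset.univ (fun _ => (1 : Hecke F n)) ∘ sumElt F Finset.univ =
      heckeElt F (n := n) ∘ Subtype.val := funext fun w => by
    rw [Function.comp_apply, sumToModule_sumElt, smul_eq_mul, mul_one, Function.comp_apply]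
  have hsurj : Function.Surjective (Subtype.val :
      {w : Equiv.Perm (Fin n) // descents w ⊆ Finset.univ} → Equiv.Perm (Fin n)) :=
    fun w => ⟨⟨w, Finset.subset_univ _⟩, rfl⟩
  refine bijective_of_sumElt _ ?_ ?_
  · rw [hφ]
    exact (linearIndependent_heckeElt F).comp _ Subtype.val_injective
  · rw [hφ, hsurj.range_comp]
    exact span_heckeElt F

theorem projective_of_directSum {R ι : Type*} [Semiring R] {M : ι → Type*}
    [∀ i, AddCommMonoid (M i)] [∀ i, Module R (M i)] [Module.Projective R (DirectSum ι M)] (i : ι) :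
    Module.Projective R (M i) := by
  classical
  exact Module.Projective.of_split (DirectSum.lof R ι M i) (DirectSum.component R ι M i)
    (LinearMap.ext fun x => DirectSum.component.lof_self R i x)

theorem projective_projIndec (α : Composition n) :
    Module.Projective (Hecke F n) (projIndec F α) := by
  classical
  have hproj : Module.Projective (Hecke F n) (DirectSum
      {α : Composition n // compDescents α ⊆ (Finset.univ : Finset (Fin (n - 1)))}
      fun α => projIndec F α.1) := by
    let e := LinearEquiv.ofBijective _ (bijective_sumToModule_one (F := F) (n := n))
    exact Module.Projective.of_split e.toLinearMap e.symm.toLinearMap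
      (LinearMap.ext fun x => e.symm_apply_apply x)
  exact projective_of_directSum (R := Hecke F n)
    (M := fun α : {α : Composition n // compDescents α ⊆ (Finset.univ : Finset (Fin (n - 1)))} =>
      projIndec F α.1) ⟨α, Finset.subset_univ _⟩

end HeckeAlgebra

/-! ### The action of the 0-Hecke algebra on `R_μ` -/

section Springer

variable {F : Type*} [Field F] {n : ℕ} {μ : n.Partition} {h : ℕ}

theorem HookWith.mk_demazureBar_surjInv (hμ : HookWith μ h) (i : Fin (n - 1))
    (f : MvPolynomial (Fin n) F) :
    Ideal.Quotient.mk (tanisaki F μ) (demazureBar F i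
      (Function.surjInv Ideal.Quotient.mk_surjective (Ideal.Quotient.mk (tanisaki F μ) f))) =
      Ideal.Quotient.mk (tanisaki F μ) (demazureBar F i f) := by
  rw [Ideal.Quotient.mk_eq_mk_iff_sub_mem, ← map_sub]
  refine hμ.demazureBar_mem_tanisaki F ?_ i
  rw [← Ideal.Quotient.mk_eq_mk_iff_sub_mem]
  exact Function.surjInv_eq Ideal.Quotient.mk_surjective _

variable (F) in
/-- The operator induced by `π̄_i` on `R_μ`, computed on an arbitrary lift. -/
def HookWith.demazureBarQuot (hμ : HookWith μ h) (i : Fin (n - 1)) :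
    Module.End F (springerRing F μ) where
  toFun y := Ideal.Quotient.mk (tanisaki F μ) (demazureBar F i
    (Function.surjInv Ideal.Quotient.mk_surjective y))
  map_add' y z := by
    obtain ⟨f, rfl⟩ := Ideal.Quotient.mk_surjective y
    obtain ⟨g, rfl⟩ := Ideal.Quotient.mk_surjective z
    rw [← map_add, hμ.mk_demazureBar_surjInv, hμ.mk_demazureBar_surjInv,
      hμ.mk_demazureBar_surjInv, map_add, map_add]
  map_smul' r y := by
    obtain ⟨f, rfl⟩ := Ideal.Quotient.mk_surjective y
    change Ideal.Quotient.mk (tanisaki F μ) (demazureBar F i (Function.surjInv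
      Ideal.Quotient.mk_surjective (Ideal.Quotient.mk (tanisaki F μ) (r • f)))) = r • _
    rw [hμ.mk_demazureBar_surjInv, hμ.mk_demazureBar_surjInv, map_smul]
    rfl

theorem HookWith.demazureBarQuot_mk (hμ : HookWith μ h) (i : Fin (n - 1))
    (f : MvPolynomial (Fin n) F) :
    hμ.demazureBarQuot F i (Ideal.Quotient.mk (tanisaki F μ) f) =
      Ideal.Quotient.mk (tanisaki F μ) (demazureBar F i f) :=
  hμ.mk_demazureBar_surjInv i f

theorem HookWith.demazureBarQuot_mul_self (hμ : HookWith μ h) (i : Fin (n - 1)) :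
    hμ.demazureBarQuot F i * hμ.demazureBarQuot F i = -hμ.demazureBarQuot F i := by
  refine LinearMap.ext fun y => ?_
  obtain ⟨f, rfl⟩ := Ideal.Quotient.mk_surjective y
  rw [Module.End.mul_apply, LinearMap.neg_apply, hμ.demazureBarQuot_mk, hμ.demazureBarQuot_mk,
    ← map_neg]
  exact congrArg _ (LinearMap.congr_fun (demazureBar_mul_self F i) f)

theorem HookWith.braidFamily_demazureBarQuot (hμ : HookWith μ h) :
    BraidFamily (hμ.demazureBarQuot F) where
  comm i j hij := by
    refine LinearMap.ext fun y => ?_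
    obtain ⟨f, rfl⟩ := Ideal.Quotient.mk_surjective y
    simp only [Module.End.mul_apply, hμ.demazureBarQuot_mk]
    exact congrArg _ (LinearMap.congr_fun ((braidFamily_demazureBar F).comm i j hij) f)
  braid i j hij := by
    refine LinearMap.ext fun y => ?_
    obtain ⟨f, rfl⟩ := Ideal.Quotient.mk_surjective y
    simp only [Module.End.mul_apply, hμ.demazureBarQuot_mk]
    exact congrArg _ (LinearMap.congr_fun ((braidFamily_demazureBar F).braid i j hij) f)

variable (F) in
/-- The representation of `H_n(0)` on `R_μ`. -/
def HookWith.springerRep (hμ : HookWith μ h) : Hecke F n →ₐ[F] Module.End F (springerRing F μ) :=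
  heckeLift (hμ.demazureBarQuot F) hμ.demazureBarQuot_mul_self hμ.braidFamily_demazureBarQuot

theorem HookWith.springerRep_T (hμ : HookWith μ h) (i : Fin (n - 1))
    (f : MvPolynomial (Fin n) F) :
    hμ.springerRep F (T F i) (Ideal.Quotient.mk (tanisaki F μ) f) =
      Ideal.Quotient.mk (tanisaki F μ) (demazureBar F i f) := by
  rw [springerRep, heckeLift_T, hμ.demazureBarQuot_mk]

theorem HookWith.springerRep_Tperm (hμ : HookWith μ h) (w : Equiv.Perm (Fin n))
    (f : MvPolynomial (Fin n) F) :
    hμ.springerRep F (Tperm F w) (Ideal.Quotient.mk (tanisaki F μ) f) =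
      Ideal.Quotient.mk (tanisaki F μ) (demazureBarPerm F w f) := by
  rw [Tperm, demazureBarPerm]
  induction reducedWord w with
  | nil => simp
  | cons i l ih =>
    rw [List.map_cons, List.map_cons, List.prod_cons, List.prod_cons, map_mul,
      Module.End.mul_apply, Module.End.mul_apply, ih, hμ.springerRep_T]

theorem demazureBar_xMonomial {I : Finset (Fin (n - 1))} {i : Fin (n - 1)} (hi : i ∉ I) :
    demazureBar F i (xMonomial F I) = 0 := by
  rw [xMonomial_eq]
  refine demazureBar_eq_zero F (rename_adjSwap_monomial F ?_)
  have := expOf_lo 0 I i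
  rw [if_neg hi] at this
  simpa [expOf] using this

/-- `T_w T'_{w₀(D(w)ᶜ)}` sends `x_{D(w)}` to the Demazure atom of `w`, since the operators `π̄_i`
with `i ∉ D(w)` annihilate `x_{D(w)}`. -/
theorem HookWith.springerRep_heckeElt (hμ : HookWith μ h) (w : Equiv.Perm (Fin n)) :
    hμ.springerRep F (heckeElt F w)
      (Ideal.Quotient.mk (tanisaki F μ) (xMonomial F (descents w))) =
      Ideal.Quotient.mk (tanisaki F μ) (atom F w) := by
  have key : ∀ l : List (Fin (n - 1)), (∀ i ∈ l, i ∈ (descents w)ᶜ) →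
      hμ.springerRep F (l.map (T' F)).prod
        (Ideal.Quotient.mk (tanisaki F μ) (xMonomial F (descents w))) =
        Ideal.Quotient.mk (tanisaki F μ) (xMonomial F (descents w)) := by
    intro l
    induction l with
    | nil => simp
    | cons i l ih =>
      intro hl
      rw [List.forall_mem_cons, Finset.mem_compl] at hl
      rw [List.map_cons, List.prod_cons, map_mul, Module.End.mul_apply, ih hl.2, T', map_add,
        map_one, LinearMap.add_apply, hμ.springerRep_T, demazureBar_xMonomial hl.1, map_zero,
        zero_add, Module.End.one_apply]
  rw [heckeElt, map_mul, Module.End.mul_apply, Tperm',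
    key _ mem_of_mem_reducedWord_longest, hμ.springerRep_Tperm, atom]

end Springer

end ZeroHecke

end

theorem mainTheorem5 (F : Type*) [Field F] (n : ℕ) (μ : n.Partition)
    (hμ : ZeroHecke.IsHook μ) :
    ∃ _inst : Module (ZeroHecke.Hecke F n) (ZeroHecke.springerRing F μ),
      IsScalarTower F (ZeroHecke.Hecke F n) (ZeroHecke.springerRing F μ) ∧
      (∀ (i : Fin (n - 1)) (f : MvPolynomial (Fin n) F),
        ZeroHecke.T F i • (Ideal.Quotient.mk (ZeroHecke.tanisaki F μ) f)
          = Ideal.Quotient.mk (ZeroHecke.tanisaki F μ) (ZeroHecke.demazureBar F i f)) ∧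
      Module.Projective (ZeroHecke.Hecke F n) (ZeroHecke.springerRing F μ) ∧
      Nonempty (ZeroHecke.springerRing F μ ≃ₗ[ZeroHecke.Hecke F n]
        DirectSum {α : Composition n // ZeroHecke.CompLE α (ZeroHecke.toComposition μ)}
          (fun α => ZeroHecke.projIndec F α.1)) ∧
      ∃ b : Module.Basis
          {w : Equiv.Perm (Fin n) //
            ZeroHecke.descents w ⊆ ZeroHecke.compDescents (ZeroHecke.toComposition μ)}
          F (ZeroHecke.springerRing F μ),
        ∀ w, b w = Ideal.Quotient.mk (ZeroHecke.tanisaki F μ) (ZeroHecke.atom F w.1) := by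
  classical
  obtain ⟨h, h₁, h₂, h₃⟩ := hμ
  have hμ : ZeroHecke.HookWith μ h := ⟨h₁, h₂, h₃⟩
  let inst : Module (ZeroHecke.Hecke F n) (ZeroHecke.springerRing F μ) :=
    Module.compHom _ (hμ.springerRep F).toRingHom
  have hsmul : ∀ (x : ZeroHecke.Hecke F n) (y : ZeroHecke.springerRing F μ),
      x • y = hμ.springerRep F x y := fun _ _ => rfl
  have htower : IsScalarTower F (ZeroHecke.Hecke F n) (ZeroHecke.springerRing F μ) :=
    ⟨fun r x y => by rw [hsmul, hsmul, map_smul, LinearMap.smul_apply]⟩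
  let φ := ZeroHecke.sumToModule (F := F)
    (ZeroHecke.compDescents (ZeroHecke.toComposition μ)) fun α =>
      Ideal.Quotient.mk (ZeroHecke.tanisaki F μ) (ZeroHecke.xMonomial F (ZeroHecke.compDescents α))
  have hφ : φ ∘ ZeroHecke.sumElt F _ = ZeroHecke.atomImage F μ := funext fun w => by
    rw [Function.comp_apply, ZeroHecke.sumToModule_sumElt, ZeroHecke.compDescents_descentComp,
      hsmul,
      hμ.springerRep_heckeElt]
    rfl
  have hbij : Function.Bijective φ := ZeroHecke.bijective_of_sumElt φ
    (by rw [hφ]; exact hμ.linearIndependent_atomImage F) (by rw [hφ]; exact hμ.span_atomImage F)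
  let e := LinearEquiv.ofBijective φ hbij
  have hproj : ∀ α, Module.Projective (ZeroHecke.Hecke F n) (ZeroHecke.projIndec F α) :=
    ZeroHecke.projective_projIndec
  refine ⟨inst, htower, fun i f => hμ.springerRep_T i f, ?_, ⟨e.symm⟩, hμ.atomBasis F, fun w => ?_⟩
  · exact Module.Projective.of_split e.symm.toLinearMap e.toLinearMap
      (LinearMap.ext fun x => e.apply_symm_apply x)
  · rw [ZeroHecke.HookWith.atomBasis, Module.Basis.mk_apply]
    rfl
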